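/- **Setting.** Let $\mathcal G$ be an $N$-player stochastic hierarchical convex game. Player $i$ chooses $x^i$ in a nonempty closed convex set $\mathcal X_i\subseteq\mathbb R^{n_i}$; write $\mathcal X=\prod_i\mathcal X_i$ and $x=(x^i,x^{-i})$. Let $\eta>0$, let $\mathbb B_i$ be the closed unit ball of $\mathbb R^{n_i}$, and let $D_i\supseteq\mathcal X_i+\eta\mathbb B_i$ be an open convex set (for instance $\mathbb R^{n_i}$). For $x^i\in D_i$, $x^{j}\in\mathcal X_j$ ($j\ne i$), the cost of player $i$ is $$f_i(x)=\mathbb E\big[\tilde g_i(x,\xi)+\tilde h_i(x^i,y^i(x,\xi),\xi)\big],$$ where the integrand is integrable and $y^i(x,\xi)$ is the unique solution of the variational inequality: find $y\in\mathcal Y_i$ with $(\hat y-y)^{\mathsf T}F_i(x,y,\xi)\ge 0$ for all $\hat y\in\mathcal Y_i$; here $\mathcal Y_i\subseteq\mathbb R^{m_i}$ is closed and convex, $F_i(x,\cdot,\xi)$ is strongly monotone on $\mathcal Y_i$, and the variational inequality is solvable. For every $x^{-i}\in\mathcal X_{-i}$ the function $f_i(\cdot,x^{-i})$ is convex on $D_i$,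 and its subgradients at the points of $\mathcal X_i+\eta\mathbb B_i$ are bounded, uniformly in $i$ and in $x^{-i}\in\mathcal X_{-i}$. The $\eta$-smoothed game $\mathcal G_\eta$ has the same strategy sets and the costs $f_{i,\eta}(x)=\mathbb E[f_i(x^i+\eta u,x^{-i})]$ with $u$ uniformly distributed on $\mathbb B_i$. Suppose that $\mathcal G_\eta$ has a potential function $P_\eta$, that is, $P_\eta(v,x^{-i})-P_\eta(x)=f_{i,\eta}(v,x^{-i})-f_{i,\eta}(x)$ for all $i$, $x\in\mathcal X$, $v\in\mathcal X_i$, and that $P_\eta\ge\tilde P_\eta$ on $\mathcal X$ for a constant $\tilde P_\eta$. For $c>0$ let $$B_{i,\eta}(x)=\operatorname*{argmin}_{v\in\mathcal X_i}\Big[f_{i,\eta}(v,x^{-i})+\tfrac c2\|v-x^i\|^2\Big].$$ **Scheme (ARSPBR).** Let $\gamma_k>0$, $p_i>0$ with $\sum_ip_i=1$, and let $(\mathcal F_k)$ be a filtration (the history) to which the iterates $(x^k)$ are adapted. At step $k$ a player $i_k$ is selected with $\mathbb P(i_k=i\mid\mathcal F_k)=p_i$. Then $z^{i_k,k+1}=(1-\gamma_k)x^{i_k,k}+\gamma_kB_{i_k,\eta}(x^k)$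 and $x^{i_k,k+1}=z^{i_k,k+1}+\epsilon^{i_k,k+1}$, while $z^{j,k+1}=x^{j,k+1}=x^{j,k}$ for $j\neq i_k$. The initial point $x^0$ (for instance deterministic) and the errors $\epsilon^{i,k+1}$ are integrable, and almost surely $x^k,z^{k+1}\in\mathcal X$ for all $k\ge0$ (for $z^{k+1}$ this is automatic when $\gamma_k\le1$). **Proposition.** There is $L>0$ such that every $f_{i,\eta}(\cdot,x^{-i})$, $x^{-i}\in\mathcal X_{-i}$, is differentiable at the points of $\mathcal X_i$ with $L$-Lipschitz gradient on $\mathcal X_i$, and there are $M_i>0$ with $\|\nabla_{x^i}f_{i,\eta}(x)\|\le M_i$ for all $x\in\mathcal X$. For any such constants $L,M_1,\dots,M_N$ and any sequence $(x^k)$ generated by (ARSPBR): (a) For every $k\ge0$, $P_\eta(x^k)$ is integrable and almost surely $$\mathbb E[P_\eta(x^{k+1})-\tilde P_\eta\mid\mathcal F_k]\le P_\eta(x^k)-\tilde P_\eta-\gamma_k\Big(c-\tfrac{L\gamma_k}2\Big)\sum_{i=1}^Np_i\|B_{i,\eta}(x^k)-x^{i,k}\|^2+\sum_{i=1}^NM_i\,\mathbb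 E[\|\epsilon^{i,k+1}\|\mid\mathcal F_k].$$ (b) Suppose that either (i) $(\gamma_k)$ is nonincreasing, $\sum_k\gamma_k=\infty$, $\sum_k\gamma_k^2<\infty$ and $\gamma_k<2c/L$ for every $k$; or (ii) $\gamma_k=1$ for every $k$ and $c>L/2$. Suppose also that $\sum_{k}\sum_{i}M_i\,\mathbb E[\|\epsilon^{i,k+1}\|\mid\mathcal F_k]<\infty$ almost surely. Then almost surely $$\lim_{k\to\infty}\sum_{i=1}^N\|x^{i,k}-B_{i,\eta}(x^k)\|^2=0.\qquad(\ast)$$ (c) Suppose that $(\ast)$ holds almost surely. Then for almost every $\omega$, every limit point of $(x^k(\omega))$ is a Nash equilibrium of $\mathcal G_\eta$; and if $(x^k(\omega))$ is bounded (as is the case for almost every $\omega$ when all $\mathcal X_i$ are bounded), then the set of Nash equilibria of $\mathcal G_\eta$ is nonempty and the distance from $x^k(\omega)$ to it tends to $0$. -/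

import Mathlib

open MeasureTheory ProbabilityTheory Filter Topology

/-- Joint decisions: player `i` chooses a vector of the Euclidean space `ℝ^{n i}`. -/
abbrev Profile {N : ℕ} (n : Fin N → ℕ) : Type :=
  ∀ i : Fin N, EuclideanSpace ℝ (Fin (n i))

/-- `y` solves the variational inequality `VI(Y, F)`. -/
def IsVISolution {m : ℕ} (Y : Set (EuclideanSpace ℝ (Fin m)))
    (F : EuclideanSpace ℝ (Fin m) → EuclideanSpace ℝ (Fin m))
    (y : EuclideanSpace ℝ (Fin m)) : Prop :=
  y ∈ Y ∧ ∀ y' ∈ Y, 0 ≤ inner ℝ (y' - y) (F y)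

/-- `F` is strongly monotone on `Y`. -/
def IsStronglyMonotoneOn {m : ℕ} (Y : Set (EuclideanSpace ℝ (Fin m)))
    (F : EuclideanSpace ℝ (Fin m) → EuclideanSpace ℝ (Fin m)) : Prop :=
  ∃ σ : ℝ, 0 < σ ∧ ∀ y ∈ Y, ∀ y' ∈ Y, σ * ‖y - y'‖ ^ 2 ≤ inner ℝ (F y - F y') (y - y')

/-- The data of an `N`-player stochastic hierarchical game. -/
structure HierGame (N : ℕ) (n m : Fin N → ℕ) (Ξ : Type*) [MeasurableSpace Ξ] where
  /-- law of the randomness entering the players' problems -/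
  law : Measure Ξ
  /-- strategy sets `𝒳ᵢ` -/
  strat : ∀ i, Set (EuclideanSpace ℝ (Fin (n i)))
  /-- set of own decisions on which the `i`-th objective is considered -/
  dom : ∀ i, Set (EuclideanSpace ℝ (Fin (n i)))
  /-- lower-level feasible sets `𝒴ᵢ` -/
  lowerSet : ∀ i, Set (EuclideanSpace ℝ (Fin (m i)))
  /-- lower-level maps `Fᵢ(x, y, ξ)` -/
  lowerMap : ∀ i, Profile n → EuclideanSpace ℝ (Fin (m i)) → Ξ → EuclideanSpace ℝ (Fin (m i))
  /-- upper-level costs `g̃ᵢ(x, ξ)` -/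
  g : Fin N → Profile n → Ξ → ℝ
  /-- hierarchical costs `h̃ᵢ(xⁱ, yⁱ, ξ)` -/
  h : ∀ i, EuclideanSpace ℝ (Fin (n i)) → EuclideanSpace ℝ (Fin (m i)) → Ξ → ℝ

namespace HierGame

variable {N : ℕ} {n m : Fin N → ℕ} {Ξ : Type*} [MeasurableSpace Ξ]

/-- The product `𝒳` of the strategy sets. -/
def feasible (G : HierGame N n m Ξ) : Set (Profile n) :=
  {x | ∀ i, x i ∈ G.strat i}

/-- Profiles with `xⁱ` in the domain of player `i` and `x^{-i}` feasible. -/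
def domain (G : HierGame N n m Ξ) (i : Fin N) : Set (Profile n) :=
  {x | x i ∈ G.dom i ∧ ∀ j, j ≠ i → x j ∈ G.strat j}

/-- The lower-level response `yⁱ(x, ξ)`: the solution of `VI(𝒴ᵢ, Fᵢ(x, ·, ξ))`. -/
noncomputable def response (G : HierGame N n m Ξ) (i : Fin N) (x : Profile n) (ξ : Ξ) :
    EuclideanSpace ℝ (Fin (m i)) :=
  Classical.epsilon (IsVISolution (G.lowerSet i) (fun y => G.lowerMap i x y ξ))

/-- The sampled implicit cost of player `i`. -/
noncomputable def sampledCost (G : HierGame N n m Ξ) (i : Fin N) (x : Profile n) (ξ : Ξ) : ℝ :=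
  G.g i x ξ + G.h i (x i) (G.response i x ξ) ξ

/-- The implicit expected cost `fᵢ(xⁱ, x^{-i})`. -/
noncomputable def cost (G : HierGame N n m Ξ) (i : Fin N) (x : Profile n) : ℝ :=
  ∫ ξ, G.sampledCost i x ξ ∂G.law

/-- Hierarchical convex game: closed convex strategy sets, lower-level problems with a unique
solution (solvable and strongly monotone), finite expected costs, and convexity of each player's
implicit expected cost in her own decision. -/
structure IsHierConvex (G : HierGame N n m Ξ) : Prop where
  prob : IsProbabilityMeasure G.law
  strat_nonempty : ∀ i, (G.strat i).Nonempty
  strat_closed : ∀ i, IsClosed (G.strat i)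
  strat_convex : ∀ i, Convex ℝ (G.strat i)
  dom_open : ∀ i, IsOpen (G.dom i)
  dom_convex : ∀ i, Convex ℝ (G.dom i)
  lowerSet_closed : ∀ i, IsClosed (G.lowerSet i)
  lowerSet_convex : ∀ i, Convex ℝ (G.lowerSet i)
  lower_stronglyMonotone : ∀ i, ∀ x ∈ G.domain i, ∀ ξ,
    IsStronglyMonotoneOn (G.lowerSet i) (fun y => G.lowerMap i x y ξ)
  lower_solvable : ∀ i, ∀ x ∈ G.domain i, ∀ ξ,
    ∃ y, IsVISolution (G.lowerSet i) (fun y => G.lowerMap i x y ξ) y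
  integrable : ∀ i, ∀ x ∈ G.domain i, Integrable (G.sampledCost i x) G.law
  cost_convex : ∀ i, ∀ x ∈ G.feasible,
    ConvexOn ℝ (G.dom i) (fun v => G.cost i (Function.update x i v))

/-- `d` is a subgradient of `fᵢ(·, x^{-i})` at `xⁱ`. -/
def IsPartialSubgradient (G : HierGame N n m Ξ) (i : Fin N) (x : Profile n)
    (d : EuclideanSpace ℝ (Fin (n i))) : Prop :=
  ∀ v ∈ G.dom i, G.cost i x + inner ℝ d (v - x i) ≤ G.cost i (Function.update x i v)

/-- The subgradients of `fᵢ(·, x^{-i})` at the points of `𝒳ᵢ + η𝔹ᵢ` are bounded, uniformly in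
the feasible rival decisions. -/
def HasBoundedSubgradients (G : HierGame N n m Ξ) (η : ℝ) : Prop :=
  ∃ C : ℝ, ∀ i, ∀ x ∈ G.feasible, ∀ v ∈ Metric.closedBall (x i) η,
    ∀ d, G.IsPartialSubgradient i (Function.update x i v) d → ‖d‖ ≤ C

/-- The `η`-smoothed cost `f_{i,η}(x) = 𝔼[fᵢ(xⁱ + η u, x^{-i})]`, where `u` is uniformly
distributed on the closed unit ball of `ℝ^{n i}`. -/
noncomputable def smoothedCost (G : HierGame N n m Ξ) (η : ℝ) (i : Fin N) (x : Profile n) : ℝ :=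
  ⨍ u in Metric.closedBall (0 : EuclideanSpace ℝ (Fin (n i))) 1,
    G.cost i (Function.update x i (x i + η • u))

/-- The partial gradient `∇_{xⁱ} f_{i,η}(x)`. -/
noncomputable def smoothedGrad (G : HierGame N n m Ξ) (η : ℝ) (i : Fin N) (x : Profile n) :
    EuclideanSpace ℝ (Fin (n i)) :=
  gradient (fun v => G.smoothedCost η i (Function.update x i v)) (x i)

/-- Each `f_{i,η}(·, x^{-i})` is `L`-smooth on `𝒳ᵢ`, for all feasible rival decisions. -/
structure IsSmoothWith (G : HierGame N n m Ξ) (η L : ℝ) : Prop where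
  differentiableAt : ∀ i, ∀ x ∈ G.feasible,
    DifferentiableAt ℝ (fun v => G.smoothedCost η i (Function.update x i v)) (x i)
  lipschitz : ∀ i, ∀ x ∈ G.feasible, ∀ v ∈ G.strat i,
    ‖G.smoothedGrad η i x - G.smoothedGrad η i (Function.update x i v)‖ ≤ L * ‖x i - v‖

/-- `M i` bounds the norm of `∇_{xⁱ} f_{i,η}` over `𝒳`. -/
def GradBoundedBy (G : HierGame N n m Ξ) (η : ℝ) (M : Fin N → ℝ) : Prop :=
  ∀ i, ∀ x ∈ G.feasible, ‖G.smoothedGrad η i x‖ ≤ M i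

/-- `P` is a potential function of the `η`-smoothed game. -/
def IsSmoothedPotential (G : HierGame N n m Ξ) (η : ℝ) (P : Profile n → ℝ) : Prop :=
  ∀ i, ∀ x ∈ G.feasible, ∀ v ∈ G.strat i,
    P (Function.update x i v) - P x =
      G.smoothedCost η i (Function.update x i v) - G.smoothedCost η i x

/-- The set of Nash equilibria of the `η`-smoothed game. -/
def smoothedNash (G : HierGame N n m Ξ) (η : ℝ) : Set (Profile n) :=
  {x | x ∈ G.feasible ∧ ∀ i, ∀ v ∈ G.strat i,
    G.smoothedCost η i x ≤ G.smoothedCost η i (Function.update x i v)}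

/-- The smoothed proximal best response `B_{i,η}(x)`: the minimizer over `v ∈ 𝒳ᵢ` of
`f_{i,η}(v, x^{-i}) + (c/2)‖v - xⁱ‖²`. -/
noncomputable def proxResponse (G : HierGame N n m Ξ) (η c : ℝ) (i : Fin N) (x : Profile n) :
    EuclideanSpace ℝ (Fin (n i)) :=
  Classical.epsilon fun v => v ∈ G.strat i ∧
    IsMinOn (fun w => G.smoothedCost η i (Function.update x i w) + c / 2 * ‖w - x i‖ ^ 2)
      (G.strat i) v

/-- The residual `∑ᵢ ‖xⁱ - B_{i,η}(x)‖²`. -/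
noncomputable def proxResidual (G : HierGame N n m Ξ) (η c : ℝ) (x : Profile n) : ℝ :=
  ∑ i, ‖x i - G.proxResponse η c i x‖ ^ 2

/-- The exact relaxed step from `x` with weight `t` when player `s` is selected. -/
noncomputable def relaxedStep (G : HierGame N n m Ξ) (η c t : ℝ) (x : Profile n) (s : Fin N) :
    Profile n :=
  fun i => if i = s then (1 - t) • x i + t • G.proxResponse η c i x else x i

/-- `x` is a sequence generated by the asynchronous relaxed smoothed proximal best-response
scheme with relaxation sequence `γ`, selection probabilities `p`, selected players `sel`, errors
`e` and history `ℱ`. -/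
structure IsARSPBR (G : HierGame N n m Ξ) (η c : ℝ) (γ : ℕ → ℝ) (p : Fin N → ℝ)
    {Ω : Type*} {mΩ : MeasurableSpace Ω} (μ : Measure Ω) (ℱ : Filtration ℕ mΩ)
    (x : ℕ → Ω → Profile n) (sel : ℕ → Ω → Fin N) (e : ℕ → Ω → Profile n) : Prop where
  prob_pos : ∀ i, 0 < p i
  prob_sum : ∑ i, p i = 1
  relax_pos : ∀ k, 0 < γ k
  adapted : ∀ k, StronglyMeasurable[ℱ k] (x k)
  init_integrable : Integrable (x 0) μ
  sel_measurable : ∀ k, Measurable (sel k)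
  /-- given the history, player `i` is selected with probability `p i` -/
  sel_prob : ∀ k i, μ⟦sel k ⁻¹' {i} | ℱ k⟧ =ᵐ[μ] fun _ => p i
  error_integrable : ∀ k, Integrable (e (k + 1)) μ
  update : ∀ᵐ ω ∂μ, ∀ k i, x (k + 1) ω i =
    G.relaxedStep η c (γ k) (x k ω) (sel k ω) i + if i = sel k ω then e (k + 1) ω i else 0
  /-- the iterates `x^k` and the exact relaxed steps `z^{k+1}` are feasible -/
  feasible : ∀ᵐ ω ∂μ, ∀ k, x k ω ∈ G.feasible ∧
    G.relaxedStep η c (γ k) (x k ω) (sel k ω) ∈ G.feasible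

end HierGame

/-! Averaging over a ball turns the bounded, almost everywhere defined gradient of a convex cost
into a Lipschitz one. The gradient of the average is the average of the gradient, and averages of a
bounded function over two balls of radius `η` differ by a multiple of the relative volume of the
non-overlapping parts, which is linear in the distance of the centres. This yields `L` and the `M
i`.

For (a), write `B` for the proximal response. Its optimality condition and monotonicity of the
gradient give `⟨∇f(x), B - x⟩ ≤ -c‖B - x‖²`; by the descent lemma a step of weight `t` then lowers
the cost by at least `t(c - Lt/2)‖B - x‖²`. The potential inherits this decrease. It is Lipschitz in
coordinate `i` with constant `M i`, which prices the errors, and conditioning on the history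
averages over the selected player.

For (b), a Robbins–Siegmund argument (`ae_summable_of_condExp_le`) makes `∑ γ k ‖B - x‖²` finite
almost surely. For constant weights this is enough. For diminishing weights it only makes each
player's displacement small infinitely often; `UniformContinuousOn.tendsto_zero_of_summable_mul_sq`
upgrades this to a limit, provided `B` is uniformly continuous in the whole profile. No continuity
of the costs in the rivals' decisions is assumed: the potential supplies it. In the own coordinate
`B` also minimizes `P` plus the proximal term, `P` is jointly Lipschitz because coordinates can be
changed one at a time, and quadratic growth then makes `B` locally Hölder of exponent 1/2.

For (c), fixed points of all proximal responses are equilibria by convexity, continuity of `B`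
carries the vanishing residual to limit points, and compactness handles the distance. -/

/-! ### Proximal minimization. -/

/-- Quadratic growth of the proximal objective at its minimizer. -/
theorem ConvexOn.prox_growth {E : Type*} [NormedAddCommGroup E] [InnerProductSpace ℝ E]
    {φ : E → ℝ} {S : Set E} {a w : E} (hφ : ConvexOn ℝ S φ) {c : ℝ} {b : E} (hb : b ∈ S)
    (hmin : IsMinOn (fun z => φ z + c / 2 * ‖z - a‖ ^ 2) S b) (hw : w ∈ S) :
    φ b + c / 2 * ‖b - a‖ ^ 2 + c / 2 * ‖w - b‖ ^ 2 ≤ φ w + c / 2 * ‖w - a‖ ^ 2 := by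
  -- Compare `b` with `(1 - t) • b + t • w`, use convexity of `φ` and the exact expansion of the
  -- squared norm, and divide by `t`; the leftover term is of order `t` and vanishes in the limit.
  have key : ∀ t ∈ Set.Ioc (0 : ℝ) 1, φ b + c / 2 * ‖b - a‖ ^ 2 + c / 2 * ‖w - b‖ ^ 2
      ≤ φ w + c / 2 * ‖w - a‖ ^ 2 + t * (c / 2 * ‖w - b‖ ^ 2) := by
    intro t ht
    have hz := hφ.1 hb hw (sub_nonneg.2 ht.2) ht.1.le (by ring : 1 - t + t = 1)
    have h1 := hφ.2 hb hw (sub_nonneg.2 ht.2) ht.1.le (by ring : 1 - t + t = 1)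
    have h2 := hmin hz
    simp only [Set.mem_ofPred_eq, smul_eq_mul] at h1 h2
    have h3 : ‖(1 - t) • b + t • w - a‖ ^ 2
        = (1 - t) * ‖b - a‖ ^ 2 + t * ‖w - a‖ ^ 2 - t * (1 - t) * ‖w - b‖ ^ 2 := by
      have e1 : (1 - t) • b + t • w - a = (b - a) + t • (w - b) := by module
      have e2 : w - a = (b - a) + (w - b) := by abel
      rw [e1, e2, norm_add_sq_real, norm_add_sq_real, inner_smul_right, norm_smul,
        Real.norm_eq_abs, mul_pow, sq_abs]
      ring
    rw [h3] at h2
    have h4 : 0 ≤ t * (φ w + c / 2 * ‖w - a‖ ^ 2 + t * (c / 2 * ‖w - b‖ ^ 2)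
        - (φ b + c / 2 * ‖b - a‖ ^ 2 + c / 2 * ‖w - b‖ ^ 2)) := by nlinarith
    have h5 := nonneg_of_mul_nonneg_right h4 ht.1
    linarith
  have hlim : Tendsto (fun t : ℝ => φ w + c / 2 * ‖w - a‖ ^ 2 + t * (c / 2 * ‖w - b‖ ^ 2))
      (𝓝[>] 0) (𝓝 (φ w + c / 2 * ‖w - a‖ ^ 2 + 0 * (c / 2 * ‖w - b‖ ^ 2))) :=
    Tendsto.mono_left (Continuous.tendsto (by fun_prop) 0) nhdsWithin_le_nhds
  have := ge_of_tendsto hlim (by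
    filter_upwards [Ioc_mem_nhdsGT (zero_lt_one (α := ℝ))] with t ht using key t ht)
  simpa using this

/-- The quadratic penalty beats the linear lower bound: beyond distance `2|M|/c` from `a` the
objective exceeds its value at `a`, so minimizing over a compact piece suffices. -/
theorem IsClosed.exists_isMinOn_prox {E : Type*} [NormedAddCommGroup E] [ProperSpace E]
    {φ : E → ℝ} {S : Set E} {a : E} (hS : IsClosed S)
    (hcont : ContinuousOn φ S) {M c : ℝ} (hc : 0 < c) (ha : a ∈ S)
    (hφ : ∀ z ∈ S, φ a - M * ‖z - a‖ ≤ φ z) :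
    ∃ b ∈ S, IsMinOn (fun z => φ z + c / 2 * ‖z - a‖ ^ 2) S b := by
  have hK : IsCompact (S ∩ Metric.closedBall a (2 * |M| / c)) :=
    (isCompact_closedBall _ _).inter_left hS
  have haK : a ∈ S ∩ Metric.closedBall a (2 * |M| / c) :=
    ⟨ha, Metric.mem_closedBall_self (by positivity)⟩
  obtain ⟨b, hb, hmin⟩ := hK.exists_isMinOn ⟨a, haK⟩
    (f := fun z => φ z + c / 2 * ‖z - a‖ ^ 2)
    ((hcont.mono Set.inter_subset_left).add (by fun_prop))
  refine ⟨b, hb.1, fun z hz => ?_⟩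
  by_cases hzK : z ∈ Metric.closedBall a (2 * |M| / c)
  · exact hmin ⟨hz, hzK⟩
  · rw [mem_closedBall_iff_norm, not_le, div_lt_iff₀ hc] at hzK
    have h1 := hmin haK
    have h2 := hφ z hz
    simp only [Set.mem_ofPred_eq, sub_self, norm_zero] at h1 ⊢
    have h3 := mul_le_mul_of_nonneg_right (le_abs_self M) (norm_nonneg (z - a))
    nlinarith [norm_nonneg (z - a), mul_le_mul_of_nonneg_right hzK.le (norm_nonneg (z - a))]

/-! ### Gradient inequalities on convex sets. -/

section ConvexGradient

variable {E : Type*} [NormedAddCommGroup E] [InnerProductSpace ℝ E] [CompleteSpace E]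
  {φ : E → ℝ} {S : Set E} {g : E → E} {a v w : E}

theorem HasGradientAt.hasDerivAt_comp_add_smul {d p : E} {t : ℝ}
    (h : HasGradientAt φ d (v + t • p)) :
    HasDerivAt (fun s : ℝ => φ (v + s • p)) (inner ℝ d p) t := by
  have h1 : HasDerivAt (fun s : ℝ => v + s • p) p t := by
    simpa using ((hasDerivAt_id t).smul_const p).const_add v
  exact (h.hasFDerivAt.comp_hasDerivAt t h1).congr_deriv (by simp)

theorem ConvexOn.add_inner_le (hφ : ConvexOn ℝ S φ) {d : E} (hd : HasGradientAt φ d v)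
    (hv : v ∈ S) (hw : w ∈ S) : φ v + inner ℝ d (w - v) ≤ φ w := by
  have h0 : HasGradientAt φ d (v + (0 : ℝ) • (w - v)) := by simpa using hd
  have h1 := h0.hasDerivAt_comp_add_smul
  have h2 : ConvexOn ℝ (Set.Icc (0 : ℝ) 1) (fun s : ℝ => φ (v + s • (w - v))) := by
    refine ⟨convex_Icc 0 1, ?_⟩
    intro s hs t ht α β hα hβ hαβ
    have hs' := hφ.1.add_smul_sub_mem hv hw hs
    have ht' := hφ.1.add_smul_sub_mem hv hw ht
    have := hφ.2 hs' ht' hα hβ hαβ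
    convert this using 2
    have hβ' : β = 1 - α := by linarith
    subst hβ'
    simp only [smul_eq_mul]
    module
  have h3 := h2.le_slope_of_hasDerivAt (Set.left_mem_Icc.2 zero_le_one)
    (Set.right_mem_Icc.2 zero_le_one) zero_lt_one h1
  simp [slope_def_field] at h3
  linarith

theorem ConvexOn.inner_gradient_mono (hφ : ConvexOn ℝ S φ)
    (hg : ∀ z ∈ S, HasGradientAt φ (g z) z) (hv : v ∈ S) (hw : w ∈ S) :
    inner ℝ (g v) (w - v) ≤ inner ℝ (g w) (w - v) := by
  have h1 := hφ.add_inner_le (hg v hv) hv hw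
  have h2 := hφ.add_inner_le (hg w hw) hw hv
  have h3 : inner ℝ (g w) (v - w) = - inner ℝ (g w) (w - v) := by
    rw [← inner_neg_right, neg_sub]
  linarith

/-- Descent lemma on a convex set. -/
theorem Convex.le_add_inner_add_sq (hS : Convex ℝ S)
    (hg : ∀ z ∈ S, HasGradientAt φ (g z) z) {L : ℝ}
    (hL : ∀ z ∈ S, ∀ z' ∈ S, ‖g z - g z'‖ ≤ L * ‖z - z'‖) (hv : v ∈ S) (hw : w ∈ S) :
    φ w ≤ φ v + inner ℝ (g v) (w - v) + L / 2 * ‖w - v‖ ^ 2 := by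
  set p := w - v with hp
  have hmem : ∀ t ∈ Set.Icc (0 : ℝ) 1, v + t • p ∈ S := fun t ht =>
    hS.add_smul_sub_mem hv hw ht
  have hd : ∀ t ∈ Set.Icc (0 : ℝ) 1, HasDerivAt
      (fun s : ℝ => φ (v + s • p) - s * inner ℝ (g v) p - L / 2 * s ^ 2 * ‖p‖ ^ 2)
      (inner ℝ (g (v + t • p)) p - inner ℝ (g v) p - L * t * ‖p‖ ^ 2) t := by
    intro t ht
    have h1 := (hg _ (hmem t ht)).hasDerivAt_comp_add_smul
    have h2 := ((hasDerivAt_id t).mul_const (inner ℝ (g v) p))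
    have h3 := ((((hasDerivAt_id t).pow 2).const_mul (L / 2)).mul_const (‖p‖ ^ 2))
    refine ((h1.sub h2).sub h3).congr_deriv ?_
    simp only [id_eq, pow_one, Nat.cast_ofNat, mul_one, one_mul, Nat.add_one_sub_one]
    ring
  -- Subtracting the linear and quadratic terms leaves a function of `s` whose derivative is
  -- nonpositive, by Cauchy–Schwarz and the Lipschitz bound; comparing its values at 0 and 1 is the
  -- claim.
  have hanti : AntitoneOn
      (fun s : ℝ => φ (v + s • p) - s * inner ℝ (g v) p - L / 2 * s ^ 2 * ‖p‖ ^ 2)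
      (Set.Icc 0 1) := by
    refine antitoneOn_of_deriv_nonpos (convex_Icc 0 1)
      (fun t ht => (hd t ht).continuousAt.continuousWithinAt)
      (fun t ht => (hd t (interior_subset ht)).differentiableAt.differentiableWithinAt) ?_
    intro t ht
    have ht' := interior_subset ht
    rw [(hd t ht').deriv, ← inner_sub_left]
    have h1 := real_inner_le_norm (g (v + t • p) - g v) p
    have h2 := hL _ (hmem t ht') v hv
    rw [add_sub_cancel_left, norm_smul, Real.norm_eq_abs, abs_of_nonneg ht'.1] at h2
    nlinarith [mul_le_mul_of_nonneg_right h2 (norm_nonneg p)]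
  have h := hanti (Set.left_mem_Icc.2 zero_le_one) (Set.right_mem_Icc.2 zero_le_one) zero_le_one
  simp [hp] at h
  rw [hp]
  linarith

theorem Convex.abs_sub_le_of_gradient_bound (hS : Convex ℝ S)
    (hg : ∀ z ∈ S, HasGradientAt φ (g z) z) {M : ℝ} (hM : ∀ z ∈ S, ‖g z‖ ≤ M)
    (hv : v ∈ S) (hw : w ∈ S) : |φ w - φ v| ≤ M * ‖w - v‖ := by
  have := hS.norm_image_sub_le_of_norm_hasFDerivWithin_le (𝕜 := ℝ) (f := φ) (C := M)
    (fun z hz => (hg z hz).hasFDerivAt.hasFDerivWithinAt)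
    (fun z hz => by simpa using hM z hz) hv hw
  simpa using this

theorem IsMinOn.inner_nonneg_of_convex {d b : E} (hS : Convex ℝ S) (hb : b ∈ S)
    (hd : HasGradientAt φ d b) (hmin : IsMinOn φ S b) (hw : w ∈ S) :
    0 ≤ inner ℝ d (w - b) := by
  have h0 : HasGradientAt φ d (b + (0 : ℝ) • (w - b)) := by simpa using hd
  have h1 := h0.hasDerivAt_comp_add_smul
  have h2 := h1.hasDerivWithinAt (s := Set.Ioi 0)
  rw [hasDerivWithinAt_iff_tendsto_slope' (by simp)] at h2
  refine ge_of_tendsto h2 ?_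
  filter_upwards [Ioc_mem_nhdsGT (zero_lt_one (α := ℝ))] with t ht
  have h3 := hmin (hS.add_smul_sub_mem hb hw ⟨ht.1.le, ht.2⟩)
  simp only [Set.mem_ofPred_eq] at h3
  rw [slope_def_field]
  have := ht.1
  refine div_nonneg ?_ (by linarith)
  simpa using h3

theorem ConvexOn.inner_prox_nonneg (hφ : ConvexOn ℝ S φ)
    (hg : ∀ z ∈ S, HasGradientAt φ (g z) z) {c : ℝ} {b : E} (hb : b ∈ S)
    (hmin : IsMinOn (fun z => φ z + c / 2 * ‖z - a‖ ^ 2) S b) (hw : w ∈ S) :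
    0 ≤ inner ℝ (g b) (w - b) + c * inner ℝ (b - a) (w - b) := by
  have h1 : HasGradientAt (fun z => φ z + c / 2 * ‖z - a‖ ^ 2) (g b + c • (b - a)) b := by
    rw [hasGradientAt_iff_hasFDerivAt]
    have h2 : HasFDerivAt (fun z : E => z - a) (ContinuousLinearMap.id ℝ E) b :=
      (hasFDerivAt_id b).sub_const a
    have h3 := ((hg b hb).hasFDerivAt.add (h2.norm_sq.const_mul (c / 2)))
    refine h3.congr_fderiv ?_
    ext z
    simp
    ring
  have h4 := hmin.inner_nonneg_of_convex hφ.1 hb h1 hw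
  rwa [inner_add_left, inner_smul_left] at h4

/-- The variational inequality at `b`, tested with `a`, bounds the slope at `b`; monotonicity of the
gradient moves the bound to `a`. This is the source of the constant `c` in the descent estimate. -/
theorem ConvexOn.inner_prox_le (hφ : ConvexOn ℝ S φ)
    (hg : ∀ z ∈ S, HasGradientAt φ (g z) z) {c : ℝ} {b : E} (ha : a ∈ S) (hb : b ∈ S)
    (hmin : IsMinOn (fun z => φ z + c / 2 * ‖z - a‖ ^ 2) S b) :
    inner ℝ (g a) (b - a) ≤ - c * ‖b - a‖ ^ 2 := by
  have h1 := hφ.inner_prox_nonneg hg hb hmin ha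
  have h2 := hφ.inner_gradient_mono hg ha hb
  have h3 : inner ℝ (g b) (a - b) = - inner ℝ (g b) (b - a) := by
    rw [← inner_neg_right, neg_sub]
  have h4 : inner ℝ (b - a) (a - b) = - ‖b - a‖ ^ 2 := by
    rw [← neg_sub b a, inner_neg_right, real_inner_self_eq_norm_sq]
  rw [h3, h4] at h1
  linarith

theorem ConvexOn.norm_prox_sub_le (hφ : ConvexOn ℝ S φ)
    (hg : ∀ z ∈ S, HasGradientAt φ (g z) z) {c M : ℝ} (hc : 0 < c) {b : E} (ha : a ∈ S)
    (hb : b ∈ S) (hmin : IsMinOn (fun z => φ z + c / 2 * ‖z - a‖ ^ 2) S b) (hM : ‖g a‖ ≤ M) :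
    ‖b - a‖ ≤ M / c := by
  have h1 := hφ.inner_prox_le hg ha hb hmin
  have h2 := neg_le_of_abs_le (abs_real_inner_le_norm (g a) (b - a))
  rw [le_div_iff₀ hc]
  rcases (norm_nonneg (b - a)).eq_or_lt with h | h
  · rw [← h]; simpa using (norm_nonneg _).trans hM
  · have h3 : ‖b - a‖ * (‖b - a‖ * c) ≤ ‖b - a‖ * M := by
      nlinarith [mul_le_mul_of_nonneg_right hM h.le]
    exact le_of_mul_le_mul_left h3 h

end ConvexGradient

/-! ### Averages over balls: differentiability, convexity, Lipschitz gradients. -/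

section BallAverage

set_option linter.unusedSectionVars false

variable {E : Type*} [NormedAddCommGroup E] [InnerProductSpace ℝ E] [FiniteDimensional ℝ E]
  {f : E → ℝ} {D S : Set E} {v w : E} {η : ℝ}

theorem add_smul_mem_closedBall_of_mem_unit (hη : 0 ≤ η) {u : E}
    (hu : u ∈ Metric.closedBall (0 : E) 1) : v + η • u ∈ Metric.closedBall v η := by
  rw [mem_closedBall_zero_iff] at hu
  rw [mem_closedBall_iff_norm, add_sub_cancel_left, norm_smul, Real.norm_eq_abs, abs_of_nonneg hη]
  exact mul_le_of_le_one_right hη hu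

/-- A convex function is Lipschitz on a slightly larger ball than one contained in its open
domain. -/
theorem ConvexOn.exists_lipschitzOnWith_closedBall (hD : IsOpen D) (hf : ConvexOn ℝ D f)
    (hη : 0 ≤ η) (hv : Metric.closedBall v η ⊆ D) :
    ∃ δ > 0, Metric.closedBall v (η + δ) ⊆ D ∧
      ∃ K, LipschitzOnWith K f (Metric.closedBall v (η + δ)) := by
  obtain ⟨δ, hδ, h⟩ := (isCompact_closedBall v η).exists_cthickening_subset_open hD hv
  rw [cthickening_closedBall hδ.le hη, add_comm] at h
  exact ⟨δ, hδ, h, ((hf.locallyLipschitzOn hD).mono h).exists_lipschitzOnWith_of_compact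
    (isCompact_closedBall _ _)⟩

variable [MeasurableSpace E] [BorelSpace E] (μ : Measure E) [μ.IsAddHaarMeasure]

theorem quasiMeasurePreserving_add_smul (v : E)
    (hη : η ≠ 0) : Measure.QuasiMeasurePreserving (fun u : E => v + η • u) μ μ :=
  (measurePreserving_add_left μ v).quasiMeasurePreserving.comp
    (Measure.quasiMeasurePreserving_smul μ hη)

theorem measurable_gradient (f : E → ℝ) : Measurable (gradient f) :=
  (InnerProductSpace.toDual ℝ E).symm.continuous.measurable.comp (measurable_fderiv ℝ f)

/-- Rademacher's theorem on an enlarged ball, so that boundary points of the original ball are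
interior; null sets pull back along `u ↦ v + η • u` since `η ≠ 0`. -/
theorem ConvexOn.ae_differentiableAt_add_smul (hD : IsOpen D) (hf : ConvexOn ℝ D f)
    (hη : 0 < η) (hv : Metric.closedBall v η ⊆ D) :
    ∀ᵐ u ∂μ.restrict (Metric.closedBall 0 1), DifferentiableAt ℝ f (v + η • u) := by
  obtain ⟨δ, hδ, -, K, hK⟩ := hf.exists_lipschitzOnWith_closedBall hD hη.le hv
  rw [ae_restrict_iff' measurableSet_closedBall]
  have h1 := (quasiMeasurePreserving_add_smul μ v hη.ne').ae
    (hK.ae_differentiableWithinAt_of_mem (μ := μ))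
  filter_upwards [h1] with u hu hu1
  have h2 := add_smul_mem_closedBall_of_mem_unit (v := v) hη.le hu1
  refine (hu (Metric.closedBall_subset_closedBall (by linarith) h2)).differentiableAt ?_
  exact mem_of_superset (Metric.isOpen_ball.mem_nhds
    (Metric.closedBall_subset_ball (by linarith) h2)) Metric.ball_subset_closedBall

theorem ContinuousOn.integrableOn_comp_add_smul (hη : 0 ≤ η)
    (hf : ContinuousOn f (Metric.closedBall v η)) :
    IntegrableOn (fun u => f (v + η • u)) (Metric.closedBall 0 1) μ :=
  (hf.comp (by fun_prop) fun _ hu =>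
    add_smul_mem_closedBall_of_mem_unit hη hu).integrableOn_compact (isCompact_closedBall _ _)

/-- Differentiation under the integral sign: the integrand is differentiable at `v` for almost every
`u`, and the Lipschitz constant of `f` on the enlarged ball is the dominating function. -/
theorem ConvexOn.hasGradientAt_setAverage (hD : IsOpen D) (hf : ConvexOn ℝ D f)
    (hη : 0 < η) (hv : Metric.closedBall v η ⊆ D) :
    HasGradientAt (fun w => ⨍ u in Metric.closedBall (0 : E) 1, f (w + η • u) ∂μ)
      (⨍ u in Metric.closedBall (0 : E) 1, gradient f (v + η • u) ∂μ) v := by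
  obtain ⟨δ, hδ, hδD, K, hK⟩ := hf.exists_lipschitzOnWith_closedBall hD hη.le hv
  have hball : ∀ w ∈ Metric.ball v δ, Metric.closedBall w η ⊆ Metric.closedBall v (η + δ) := by
    intro w hw
    refine Metric.closedBall_subset_closedBall' ?_
    rw [Metric.mem_ball] at hw
    linarith
  have hmem : ∀ w ∈ Metric.ball v δ, ∀ u ∈ Metric.closedBall (0 : E) 1,
      w + η • u ∈ Metric.closedBall v (η + δ) := fun w hw u hu =>
    hball w hw (add_smul_mem_closedBall_of_mem_unit hη.le hu)
  have hint : ∀ w ∈ Metric.ball v δ, IntegrableOn (fun u => f (w + η • u))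
      (Metric.closedBall 0 1) μ := fun w hw =>
    (hK.continuousOn.mono (hball w hw)).integrableOn_comp_add_smul μ hη.le
  have hvm := Metric.mem_ball_self (x := v) hδ
  obtain ⟨hI, hd⟩ := hasFDerivAt_integral_of_dominated_loc_of_lip
    (μ := μ.restrict (Metric.closedBall 0 1)) (F := fun w u => f (w + η • u)) (x₀ := v)
    (F' := fun u => fderiv ℝ f (v + η • u)) (bound := fun _ => (K : ℝ))
    (Metric.ball_mem_nhds v hδ)
    (by filter_upwards [Metric.ball_mem_nhds v hδ] with w hw
        exact (hint w hw).aestronglyMeasurable)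
    (hint v hvm)
    ((measurable_fderiv ℝ f).comp (by fun_prop)).aestronglyMeasurable
    (by
      rw [ae_restrict_iff' measurableSet_closedBall]
      refine Eventually.of_forall fun u hu => ?_
      refine LipschitzOnWith.of_dist_le_mul fun w hw w' hw' => ?_
      have := hK.dist_le_mul _ (hmem w hw u hu) _ (hmem w' hw' u hu)
      simpa using this)
    (integrableOn_const (isCompact_closedBall _ _).measure_lt_top.ne)
    (by
      filter_upwards [hf.ae_differentiableAt_add_smul μ hD hη hv] with u hu
      have h2 : HasFDerivAt (fun w : E => w + η • u) (ContinuousLinearMap.id ℝ E) v :=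
        (hasFDerivAt_id v).add_const _
      exact (hu.hasFDerivAt.comp v h2).congr_fderiv (by simp))
  rw [hasGradientAt_iff_hasFDerivAt]
  simp only [setAverage_eq]
  refine (hd.const_smul (μ.real (Metric.closedBall 0 1))⁻¹).congr_fderiv ?_
  have hIg : Integrable (fun u => gradient f (v + η • u)) (μ.restrict (Metric.closedBall 0 1)) := by
    refine hI.congr' ((measurable_gradient f).comp (by fun_prop)).aestronglyMeasurable ?_
    refine Eventually.of_forall fun u => ?_
    rw [← toDual_gradient, LinearIsometryEquiv.norm_map]
  ext z
  simp only [smul_apply, InnerProductSpace.toDual_apply_apply,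
    inner_smul_left, smul_eq_mul]
  rw [ContinuousLinearMap.integral_apply hI, real_inner_comm, ← integral_inner hIg]
  simp [inner_gradient_right]

theorem ConvexOn.setAverage_add_smul (hD : IsOpen D) (hf : ConvexOn ℝ D f) (hS : Convex ℝ S)
    (hη : 0 ≤ η) (hv : ∀ v ∈ S, Metric.closedBall v η ⊆ D) :
    ConvexOn ℝ S (fun w => ⨍ u in Metric.closedBall (0 : E) 1, f (w + η • u) ∂μ) := by
  have hint : ∀ w ∈ S, IntegrableOn (fun u => f (w + η • u)) (Metric.closedBall 0 1) μ :=
    fun w hw => ((hf.continuousOn hD).mono (hv w hw)).integrableOn_comp_add_smul μ hη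
  refine ⟨hS, fun a ha b hb s t hs ht hst => ?_⟩
  simp only [setAverage_eq, smul_eq_mul]
  have key : ∫ u in Metric.closedBall (0 : E) 1, f (s • a + t • b + η • u) ∂μ ≤
      s * ∫ u in Metric.closedBall (0 : E) 1, f (a + η • u) ∂μ +
      t * ∫ u in Metric.closedBall (0 : E) 1, f (b + η • u) ∂μ := by
    rw [← integral_const_mul, ← integral_const_mul, ← integral_add
      ((hint a ha).const_mul s) ((hint b hb).const_mul t)]
    refine setIntegral_mono_on (hint _ (hS ha hb hs ht hst))
      (((hint a ha).const_mul s).add ((hint b hb).const_mul t)) measurableSet_closedBall ?_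
    intro u hu
    have := hf.2 (hv a ha (add_smul_mem_closedBall_of_mem_unit hη hu))
      (hv b hb (add_smul_mem_closedBall_of_mem_unit hη hu)) hs ht hst
    simp only [smul_eq_mul] at this
    convert this using 2
    have hst' : s = 1 - t := by linarith
    subst hst'
    module
  have hpos : 0 ≤ (μ.real (Metric.closedBall (0 : E) 1))⁻¹ := by positivity
  nlinarith [mul_le_mul_of_nonneg_left key hpos]

/-- Moves the dependence on the centre from the integrand to the domain. The gradient being averaged
need not be continuous, so only the domains can be compared. -/
theorem setAverage_unitClosedBall_comp_add_smul {F : Type*} [NormedAddCommGroup F]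
    [NormedSpace ℝ F] (g : E → F) (hη : 0 < η) (v : E) :
    ⨍ u in Metric.closedBall (0 : E) 1, g (v + η • u) ∂μ =
      ⨍ y in Metric.closedBall v η, g y ∂μ := by
  rw [setAverage_eq, setAverage_eq,
    Measure.setIntegral_comp_smul_of_pos μ (fun y => g (v + y)) _ hη,
    smul_unitClosedBall_of_nonneg hη.le, smul_smul, ← mul_inv]
  congr 1
  · rw [Measure.addHaar_real_closedBall' μ v hη.le, mul_comm]
  · have h := (measurePreserving_add_left μ v).setIntegral_preimage_emb
      (measurableEmbedding_addLeft v) g (Metric.closedBall v η)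
    rw [← h]
    simp

/-- With `t = ‖v - w‖ / η`, the difference lies in a shell around `w` of relative volume `(1 + t) ^
d - 1`, at most `(2 ^ d - 1) * t` for `t ≤ 1`. For `t ≥ 1` the volume of the whole ball is a
sufficient bound. -/
theorem measureReal_closedBall_sdiff_le (hη : 0 < η) (v w : E) :
    μ.real (Metric.closedBall v η \ Metric.closedBall w η) ≤
      2 ^ Module.finrank ℝ E * (‖v - w‖ / η) * μ.real (Metric.closedBall (0 : E) η) := by
  have hfin : ∀ (z : E) (r : ℝ), μ (Metric.closedBall z r) ≠ ⊤ := fun z r =>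
    (isCompact_closedBall z r).measure_lt_top.ne
  have hpow : ∀ t ∈ Set.Icc (0 : ℝ) 1, ∀ d : ℕ, (1 + t) ^ d - 1 ≤ (2 ^ d - 1) * t := by
    intro t ht d
    induction d with
    | zero => simp
    | succ d ih =>
      have h2 : (1 : ℝ) ≤ 2 ^ d := one_le_pow₀ (by norm_num)
      rw [pow_succ, pow_succ]
      nlinarith [ht.1, ht.2, mul_le_mul_of_nonneg_right ih (by linarith [ht.1] : 0 ≤ 1 + t),
        mul_nonneg (sub_nonneg.2 h2) (mul_nonneg ht.1 (sub_nonneg.2 ht.2))]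
  set d := Module.finrank ℝ E
  set t := ‖v - w‖ / η with ht
  have ht0 : 0 ≤ t := by positivity
  have h2 : (1 : ℝ) ≤ 2 ^ d := one_le_pow₀ (by norm_num)
  rcases le_total t 1 with h1 | h1
  · have hsub : Metric.closedBall w η ⊆ Metric.closedBall w ((1 + t) * η) :=
      Metric.closedBall_subset_closedBall (by nlinarith)
    have hsub' : Metric.closedBall v η \ Metric.closedBall w η ⊆
        Metric.closedBall w ((1 + t) * η) \ Metric.closedBall w η := by
      refine Set.sdiff_subset_sdiff_left (Metric.closedBall_subset_closedBall' ?_)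
      rw [dist_eq_norm, ht, add_mul, div_mul_cancel₀ _ hη.ne']
      linarith
    calc μ.real (Metric.closedBall v η \ Metric.closedBall w η)
        ≤ μ.real (Metric.closedBall w ((1 + t) * η) \ Metric.closedBall w η) :=
          measureReal_mono hsub' (measure_ne_top_of_subset Set.sdiff_subset (hfin _ _))
      _ = μ.real (Metric.closedBall w ((1 + t) * η)) - μ.real (Metric.closedBall w η) :=
          measureReal_sdiff hsub measurableSet_closedBall (hfin _ _)
      _ = ((1 + t) ^ d - 1) * μ.real (Metric.closedBall (0 : E) η) := by
          rw [Measure.addHaar_real_closedBall' μ w (by positivity),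
            Measure.addHaar_real_closedBall' μ w hη.le,
            Measure.addHaar_real_closedBall' μ (0 : E) hη.le, mul_pow]
          ring
      _ ≤ _ := by
          gcongr
          nlinarith [hpow t ⟨ht0, h1⟩ d]
  · calc μ.real (Metric.closedBall v η \ Metric.closedBall w η)
        ≤ μ.real (Metric.closedBall v η) := measureReal_mono Set.sdiff_subset (hfin _ _)
      _ = 1 * μ.real (Metric.closedBall (0 : E) η) := by
          rw [Measure.addHaar_real_closedBall_center, one_mul]
      _ ≤ _ := by
          gcongr
          nlinarith

/-- Averages of a bounded function over balls of fixed radius depend Lipschitz-continuously on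
the centre. -/
theorem norm_setAverage_closedBall_sub_le {F : Type*} [NormedAddCommGroup F]
    [NormedSpace ℝ F] {g : E → F} (hg : AEStronglyMeasurable g μ) {C : ℝ} (hC : 0 ≤ C)
    (hη : 0 < η) (hv : ∀ y ∈ Metric.closedBall v η, ‖g y‖ ≤ C)
    (hw : ∀ y ∈ Metric.closedBall w η, ‖g y‖ ≤ C) :
    ‖(⨍ y in Metric.closedBall v η, g y ∂μ) - ⨍ y in Metric.closedBall w η, g y ∂μ‖ ≤
      2 * C * 2 ^ Module.finrank ℝ E / η * ‖v - w‖ := by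
  have hfin : ∀ z : E, μ (Metric.closedBall z η) < ⊤ := fun z =>
    (isCompact_closedBall z η).measure_lt_top
  have hint : ∀ z : E, (∀ y ∈ Metric.closedBall z η, ‖g y‖ ≤ C) →
      IntegrableOn g (Metric.closedBall z η) μ := fun z hz =>
    Measure.integrableOn_of_bounded (hfin z).ne hg
      ((ae_restrict_iff' measurableSet_closedBall).2 (Eventually.of_forall hz))
  have hpos : 0 < μ.real (Metric.closedBall (0 : E) η) :=
    ENNReal.toReal_pos (Metric.measure_closedBall_pos μ 0 hη).ne' (hfin 0).ne
  have hdiff : ∀ a b : E, (∀ y ∈ Metric.closedBall a η, ‖g y‖ ≤ C) →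
      ‖∫ y in Metric.closedBall a η \ Metric.closedBall b η, g y ∂μ‖ ≤
        C * (2 ^ Module.finrank ℝ E * (‖a - b‖ / η) * μ.real (Metric.closedBall (0 : E) η)) := by
    intro a b ha
    refine (norm_setIntegral_le_of_norm_le_const
      (lt_of_le_of_lt (measure_mono Set.sdiff_subset) (hfin a)) fun y hy => ha y hy.1).trans ?_
    exact mul_le_mul_of_nonneg_left (measureReal_closedBall_sdiff_le μ hη a b) hC
  have h1 := integral_inter_add_sdiff (t := Metric.closedBall w η) measurableSet_closedBall
    (hint v hv)
  have h2 := integral_inter_add_sdiff (t := Metric.closedBall v η) measurableSet_closedBall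
    (hint w hw)
  rw [Set.inter_comm] at h2
  have h3 : (∫ y in Metric.closedBall v η, g y ∂μ) - ∫ y in Metric.closedBall w η, g y ∂μ =
      (∫ y in Metric.closedBall v η \ Metric.closedBall w η, g y ∂μ) -
        ∫ y in Metric.closedBall w η \ Metric.closedBall v η, g y ∂μ := by
    rw [← h1, ← h2]; abel
  rw [setAverage_eq, setAverage_eq, Measure.addHaar_real_closedBall_center μ v,
    Measure.addHaar_real_closedBall_center μ w, ← smul_sub, norm_smul, norm_inv, Real.norm_eq_abs,
    abs_of_pos hpos, inv_mul_le_iff₀ hpos, h3]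
  refine (norm_sub_le _ _).trans ((add_le_add (hdiff v w hv) (hdiff w v hw)).trans (le_of_eq ?_))
  rw [norm_sub_rev w v]
  ring

theorem norm_setAverage_unitClosedBall_le {F : Type*} [NormedAddCommGroup F]
    [NormedSpace ℝ F] {g : E → F} {C : ℝ} (hη : 0 ≤ η)
    (hv : ∀ y ∈ Metric.closedBall v η, ‖g y‖ ≤ C) :
    ‖⨍ u in Metric.closedBall (0 : E) 1, g (v + η • u) ∂μ‖ ≤ C := by
  have hfin : μ (Metric.closedBall (0 : E) 1) < ⊤ := (isCompact_closedBall _ _).measure_lt_top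
  have hpos : 0 < μ.real (Metric.closedBall (0 : E) 1) :=
    ENNReal.toReal_pos (Metric.measure_closedBall_pos μ 0 one_pos).ne' hfin.ne
  rw [setAverage_eq, norm_smul, norm_inv, Real.norm_eq_abs, abs_of_pos hpos,
    inv_mul_le_iff₀ hpos, mul_comm]
  exact norm_setIntegral_le_of_norm_le_const hfin fun u hu =>
    hv _ (add_smul_mem_closedBall_of_mem_unit hη hu)

end BallAverage

/-! ### The smoothed game: gradients and the constants `L`, `M`. -/

namespace HierGame

variable {N : ℕ} {n m : Fin N → ℕ} {Ξ : Type*} [MeasurableSpace Ξ] {G : HierGame N n m Ξ}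
  {η L c t : ℝ} {M : Fin N → ℝ} {P : Profile n → ℝ} {x y : Profile n} {i : Fin N}

theorem update_mem_feasible (hx : x ∈ G.feasible) {v : EuclideanSpace ℝ (Fin (n i))}
    (hv : v ∈ G.strat i) : Function.update x i v ∈ G.feasible := by
  intro j
  by_cases h : j = i
  · subst h; simpa using hv
  · simpa [Function.update_of_ne h] using hx j

theorem IsHierConvex.isClosed_feasible (hG : G.IsHierConvex) : IsClosed G.feasible := by
  have : G.feasible = ⋂ i, (fun x : Profile n => x i) ⁻¹' G.strat i := by
    ext x; simp [feasible]
  rw [this]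
  exact isClosed_iInter fun i => (hG.strat_closed i).preimage (continuous_apply i)

theorem IsHierConvex.feasible_nonempty (hG : G.IsHierConvex) : G.feasible.Nonempty :=
  ⟨fun i => (hG.strat_nonempty i).some, fun i => (hG.strat_nonempty i).some_mem⟩

theorem smoothedCost_update (w : EuclideanSpace ℝ (Fin (n i))) :
    G.smoothedCost η i (Function.update x i w) =
      ⨍ u in Metric.closedBall (0 : EuclideanSpace ℝ (Fin (n i))) 1,
        G.cost i (Function.update x i (w + η • u)) := by
  simp [smoothedCost]

theorem smoothedGrad_update (w : EuclideanSpace ℝ (Fin (n i))) :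
    G.smoothedGrad η i (Function.update x i w) =
      gradient (fun v => G.smoothedCost η i (Function.update x i v)) w := by
  simp [smoothedGrad]

/-- Where the cost is differentiable its gradient is a subgradient; elsewhere `gradient` has the
default value 0. Hence the bound holds everywhere, not just almost everywhere. -/
theorem HasBoundedSubgradients.exists_gradient_bound (hG : G.IsHierConvex)
    (hdom : ∀ i, ∀ v ∈ G.strat i, Metric.closedBall v η ⊆ G.dom i)
    (hsub : G.HasBoundedSubgradients η) :
    ∃ C : ℝ, 0 ≤ C ∧ ∀ i, ∀ x ∈ G.feasible, ∀ y ∈ Metric.closedBall (x i) η,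
      ‖gradient (fun v => G.cost i (Function.update x i v)) y‖ ≤ C := by
  obtain ⟨C, hC⟩ := hsub
  refine ⟨max C 0, le_max_right _ _, fun i x hx y hy => ?_⟩
  by_cases hd : DifferentiableAt ℝ (fun v => G.cost i (Function.update x i v)) y
  · refine (hC i x hx y hy _ fun w hw => ?_).trans (le_max_left _ _)
    simpa using (hG.cost_convex i x hx).add_inner_le hd.hasGradientAt (hdom i _ (hx i) hy) hw
  · rw [gradient_eq_zero_of_not_differentiableAt hd, norm_zero]
    exact le_max_right _ _

theorem IsHierConvex.hasGradientAt_setAverage (hG : G.IsHierConvex) (hη : 0 < η)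
    (hdom : ∀ i, ∀ v ∈ G.strat i, Metric.closedBall v η ⊆ G.dom i) (hx : x ∈ G.feasible)
    {w : EuclideanSpace ℝ (Fin (n i))} (hw : w ∈ G.strat i) :
    HasGradientAt (fun v => G.smoothedCost η i (Function.update x i v))
      (⨍ u in Metric.closedBall (0 : EuclideanSpace ℝ (Fin (n i))) 1,
        gradient (fun v => G.cost i (Function.update x i v)) (w + η • u)) w := by
  have := (hG.cost_convex i x hx).hasGradientAt_setAverage volume (hG.dom_open i) hη (hdom i w hw)
  simpa only [smoothedCost_update] using this

theorem IsHierConvex.hasGradientAt_smoothedCost (hG : G.IsHierConvex) (hη : 0 < η)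
    (hdom : ∀ i, ∀ v ∈ G.strat i, Metric.closedBall v η ⊆ G.dom i) (hx : x ∈ G.feasible)
    {w : EuclideanSpace ℝ (Fin (n i))} (hw : w ∈ G.strat i) :
    HasGradientAt (fun v => G.smoothedCost η i (Function.update x i v))
      (G.smoothedGrad η i (Function.update x i w)) w := by
  rw [smoothedGrad_update]
  exact (hG.hasGradientAt_setAverage hη hdom hx hw).differentiableAt.hasGradientAt

theorem IsHierConvex.smoothedGrad_update_eq (hG : G.IsHierConvex) (hη : 0 < η)
    (hdom : ∀ i, ∀ v ∈ G.strat i, Metric.closedBall v η ⊆ G.dom i) (hx : x ∈ G.feasible)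
    {w : EuclideanSpace ℝ (Fin (n i))} (hw : w ∈ G.strat i) :
    G.smoothedGrad η i (Function.update x i w) =
      ⨍ u in Metric.closedBall (0 : EuclideanSpace ℝ (Fin (n i))) 1,
        gradient (fun v => G.cost i (Function.update x i v)) (w + η • u) := by
  rw [smoothedGrad_update]
  exact (hG.hasGradientAt_setAverage hη hdom hx hw).gradient

theorem IsHierConvex.convexOn_smoothedCost (hG : G.IsHierConvex) (hη : 0 < η)
    (hdom : ∀ i, ∀ v ∈ G.strat i, Metric.closedBall v η ⊆ G.dom i) (hx : x ∈ G.feasible)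
    (i : Fin N) :
    ConvexOn ℝ (G.strat i) (fun v => G.smoothedCost η i (Function.update x i v)) := by
  have := (hG.cost_convex i x hx).setAverage_add_smul volume (hG.dom_open i) (hG.strat_convex i)
    hη.le (hdom i)
  simpa only [smoothedCost_update] using this

theorem IsHierConvex.exists_gradBoundedBy (hG : G.IsHierConvex) (hη : 0 < η)
    (hdom : ∀ i, ∀ v ∈ G.strat i, Metric.closedBall v η ⊆ G.dom i)
    (hsub : G.HasBoundedSubgradients η) :
    ∃ M : Fin N → ℝ, (∀ i, 0 < M i) ∧ G.GradBoundedBy η M := by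
  obtain ⟨C, hC0, hC⟩ := hsub.exists_gradient_bound hG hdom
  refine ⟨fun _ => C + 1, fun _ => by positivity, fun i x hx => ?_⟩
  have h := hG.smoothedGrad_update_eq hη hdom hx (hx i)
  rw [Function.update_eq_self] at h
  rw [h]
  exact (norm_setAverage_unitClosedBall_le volume hη.le (hC i x hx)).trans (by linarith)

theorem IsHierConvex.exists_isSmoothWith (hG : G.IsHierConvex) (hη : 0 < η)
    (hdom : ∀ i, ∀ v ∈ G.strat i, Metric.closedBall v η ⊆ G.dom i)
    (hsub : G.HasBoundedSubgradients η) : ∃ L : ℝ, 0 < L ∧ G.IsSmoothWith η L := by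
  obtain ⟨C, hC0, hC⟩ := hsub.exists_gradient_bound hG hdom
  have hnn : ∀ j : Fin N, 0 ≤ 2 * C * 2 ^ n j / η := fun j => by positivity
  -- The sum over players dominates every individual constant, and the added 1 keeps `L` positive
  -- when `C = 0` or there are no players.
  refine ⟨∑ j, 2 * C * 2 ^ n j / η + 1, by positivity,
    fun i x hx => (hG.hasGradientAt_setAverage hη hdom hx (hx i)).differentiableAt,
    fun i x hx v hv => ?_⟩
  have h := hG.smoothedGrad_update_eq hη hdom hx (hx i)
  rw [Function.update_eq_self] at h
  rw [h, hG.smoothedGrad_update_eq hη hdom hx hv, setAverage_unitClosedBall_comp_add_smul _ _ hη,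
    setAverage_unitClosedBall_comp_add_smul _ _ hη]
  have hCv := hC i _ (update_mem_feasible hx hv)
  simp only [Function.update_idem, Function.update_self] at hCv
  refine (norm_setAverage_closedBall_sub_le volume
    (measurable_gradient _).aestronglyMeasurable hC0 hη (hC i x hx) hCv).trans ?_
  rw [finrank_euclideanSpace_fin]
  gcongr
  linarith [Finset.single_le_sum (fun j _ => hnn j) (Finset.mem_univ i)]

/-! ### Lipschitz continuity of the potential. -/

section Potential

theorem IsSmoothedPotential.abs_update_sub_le (hG : G.IsHierConvex) (hη : 0 < η)
    (hdom : ∀ i, ∀ v ∈ G.strat i, Metric.closedBall v η ⊆ G.dom i)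
    (hM : G.GradBoundedBy η M) (hP : G.IsSmoothedPotential η P) (hx : x ∈ G.feasible)
    {v : EuclideanSpace ℝ (Fin (n i))} (hv : v ∈ G.strat i) :
    |P (Function.update x i v) - P x| ≤ M i * ‖v - x i‖ := by
  rw [hP i x hx v hv]
  have := (hG.strat_convex i).abs_sub_le_of_gradient_bound
    (fun z hz => hG.hasGradientAt_smoothedCost hη hdom hx hz)
    (fun z hz => hM i _ (update_mem_feasible hx hz)) (hx i) hv
  simpa using this

/-- Pass from `y` to `x` by replacing one coordinate at a time; all intermediate profiles are
feasible because the feasible set is a product. -/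
theorem IsSmoothedPotential.abs_sub_le (hG : G.IsHierConvex) (hη : 0 < η)
    (hdom : ∀ i, ∀ v ∈ G.strat i, Metric.closedBall v η ⊆ G.dom i)
    (hM : G.GradBoundedBy η M) (hP : G.IsSmoothedPotential η P) (hx : x ∈ G.feasible)
    (hy : y ∈ G.feasible) : |P x - P y| ≤ ∑ i, M i * ‖x i - y i‖ := by
  classical
  have key : ∀ s : Finset (Fin N), s.piecewise x y ∈ G.feasible ∧
      |P (s.piecewise x y) - P y| ≤ ∑ i ∈ s, M i * ‖x i - y i‖ := by
    intro s
    induction s using Finset.induction_on with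
    | empty => simpa using hy
    | insert j s hj ih =>
      obtain ⟨h1, h2⟩ := ih
      rw [Finset.piecewise_insert, Finset.sum_insert hj]
      refine ⟨update_mem_feasible h1 (hx j), ?_⟩
      have h3 := hP.abs_update_sub_le hG hη hdom hM h1 (hx j)
      rw [Finset.piecewise_eq_of_notMem _ _ _ hj] at h3
      exact (_root_.abs_sub_le _ _ _).trans (add_le_add h3 h2)
  simpa using (key Finset.univ).2

theorem IsSmoothedPotential.abs_sub_le_norm (hG : G.IsHierConvex) (hη : 0 < η)
    (hdom : ∀ i, ∀ v ∈ G.strat i, Metric.closedBall v η ⊆ G.dom i)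
    (hM0 : ∀ i, 0 < M i) (hM : G.GradBoundedBy η M) (hP : G.IsSmoothedPotential η P)
    (hx : x ∈ G.feasible) (hy : y ∈ G.feasible) : |P x - P y| ≤ (∑ i, M i) * ‖x - y‖ := by
  refine (hP.abs_sub_le hG hη hdom hM hx hy).trans ?_
  rw [Finset.sum_mul]
  exact Finset.sum_le_sum fun i _ =>
    mul_le_mul_of_nonneg_left (norm_le_pi_norm (x - y) i) (hM0 i).le

theorem IsSmoothedPotential.continuousOn (hG : G.IsHierConvex) (hη : 0 < η)
    (hdom : ∀ i, ∀ v ∈ G.strat i, Metric.closedBall v η ⊆ G.dom i)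
    (hM0 : ∀ i, 0 < M i) (hM : G.GradBoundedBy η M) (hP : G.IsSmoothedPotential η P) :
    ContinuousOn P G.feasible := by
  have hK : 0 ≤ ∑ i, M i := Finset.sum_nonneg fun i _ => (hM0 i).le
  refine (LipschitzOnWith.of_dist_le_mul (K := ⟨∑ i, M i, hK⟩) fun x hx y hy => ?_).continuousOn
  rw [Real.dist_eq, dist_eq_norm]
  exact hP.abs_sub_le_norm hG hη hdom hM0 hM hx hy

end Potential

/-! ### The proximal best response: existence, fixed points, continuity. -/

section Prox

theorem IsHierConvex.proxResponse_spec (hG : G.IsHierConvex) (hη : 0 < η)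
    (hdom : ∀ i, ∀ v ∈ G.strat i, Metric.closedBall v η ⊆ G.dom i)
    (hM : G.GradBoundedBy η M) (hc : 0 < c) (hx : x ∈ G.feasible) (i : Fin N) :
    G.proxResponse η c i x ∈ G.strat i ∧
      IsMinOn (fun w => G.smoothedCost η i (Function.update x i w) + c / 2 * ‖w - x i‖ ^ 2)
        (G.strat i) (G.proxResponse η c i x) := by
  have hgrad : ∀ z ∈ G.strat i, HasGradientAt
      (fun v => G.smoothedCost η i (Function.update x i v))
      (G.smoothedGrad η i (Function.update x i z)) z :=
    fun z hz => hG.hasGradientAt_smoothedCost hη hdom hx hz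
  refine Classical.epsilon_spec (p := fun v => v ∈ G.strat i ∧
    IsMinOn (fun w => G.smoothedCost η i (Function.update x i w) + c / 2 * ‖w - x i‖ ^ 2)
      (G.strat i) v) ?_
  refine (hG.strat_closed i).exists_isMinOn_prox (M := M i)
    (fun z hz => (hgrad z hz).continuousAt.continuousWithinAt) hc (hx i) fun z hz => ?_
  have := (abs_le.1 ((hG.strat_convex i).abs_sub_le_of_gradient_bound hgrad
    (fun z hz => hM i _ (update_mem_feasible hx hz)) (hx i) hz)).1
  linarith

/-- Yields both the boundedness needed for integrability and the step length of order `γ k`. -/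
theorem IsHierConvex.norm_proxResponse_sub_le (hG : G.IsHierConvex) (hη : 0 < η)
    (hdom : ∀ i, ∀ v ∈ G.strat i, Metric.closedBall v η ⊆ G.dom i)
    (hM : G.GradBoundedBy η M) (hc : 0 < c) (hx : x ∈ G.feasible) (i : Fin N) :
    ‖G.proxResponse η c i x - x i‖ ≤ M i / c := by
  obtain ⟨h1, h2⟩ := hG.proxResponse_spec hη hdom hM hc hx i
  exact (hG.convexOn_smoothedCost hη hdom hx i).norm_prox_sub_le
    (fun z hz => hG.hasGradientAt_smoothedCost hη hdom hx hz) hc (hx i) h1 h2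
    (by simpa using hM i x hx)

/-- At a fixed point the proximal term has zero gradient, so the optimality condition is that of the
smoothed cost alone, and convexity makes it global. -/
theorem IsHierConvex.mem_smoothedNash_of_proxResponse_eq (hG : G.IsHierConvex) (hη : 0 < η)
    (hdom : ∀ i, ∀ v ∈ G.strat i, Metric.closedBall v η ⊆ G.dom i)
    (hM : G.GradBoundedBy η M) (hc : 0 < c) (hx : x ∈ G.feasible)
    (hfix : ∀ i, G.proxResponse η c i x = x i) : x ∈ G.smoothedNash η := by
  refine ⟨hx, fun i v hv => ?_⟩
  obtain ⟨h1, h2⟩ := hG.proxResponse_spec hη hdom hM hc hx i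
  have hgrad : ∀ z ∈ G.strat i, HasGradientAt
      (fun v => G.smoothedCost η i (Function.update x i v))
      (G.smoothedGrad η i (Function.update x i z)) z :=
    fun z hz => hG.hasGradientAt_smoothedCost hη hdom hx hz
  have hconv := hG.convexOn_smoothedCost hη hdom hx i
  have h3 := hconv.inner_prox_nonneg hgrad h1 h2 hv
  rw [hfix i, sub_self, inner_zero_left, mul_zero, add_zero] at h3
  have h4 := hconv.add_inner_le (hgrad _ (hx i)) (hx i) hv
  simp only [Function.update_eq_self] at h3 h4
  linarith

theorem IsSmoothedPotential.prox_growth (hG : G.IsHierConvex) (hη : 0 < η)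
    (hdom : ∀ i, ∀ v ∈ G.strat i, Metric.closedBall v η ⊆ G.dom i)
    (hM : G.GradBoundedBy η M) (hP : G.IsSmoothedPotential η P) (hc : 0 < c)
    (hx : x ∈ G.feasible) {v : EuclideanSpace ℝ (Fin (n i))} (hv : v ∈ G.strat i) :
    P (Function.update x i (G.proxResponse η c i x)) + c / 2 * ‖G.proxResponse η c i x - x i‖ ^ 2
      + c / 2 * ‖v - G.proxResponse η c i x‖ ^ 2 ≤
      P (Function.update x i v) + c / 2 * ‖v - x i‖ ^ 2 := by
  obtain ⟨h1, h2⟩ := hG.proxResponse_spec hη hdom hM hc hx i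
  have h3 := (hG.convexOn_smoothedCost hη hdom hx i).prox_growth h1 h2 hv
  have h4 := hP i x hx v hv
  have h5 := hP i x hx _ h1
  linarith

theorem norm_update_sub_update_le (x y : Profile n) (v : EuclideanSpace ℝ (Fin (n i))) :
    ‖Function.update x i v - Function.update y i v‖ ≤ ‖x - y‖ := by
  refine (pi_norm_le_iff_of_nonneg (norm_nonneg _)).2 fun j => ?_
  by_cases h : j = i
  · subst h; simp
  · simpa [Function.update_of_ne h] using norm_le_pi_norm (x - y) j

/-- The proximal best response is locally Hölder continuous on the feasible set. -/
theorem IsSmoothedPotential.norm_proxResponse_sub_sq_le (hG : G.IsHierConvex) (hη : 0 < η)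
    (hdom : ∀ i, ∀ v ∈ G.strat i, Metric.closedBall v η ⊆ G.dom i)
    (hM0 : ∀ i, 0 < M i) (hM : G.GradBoundedBy η M) (hP : G.IsSmoothedPotential η P)
    (hc : 0 < c) (hx : x ∈ G.feasible) (hy : y ∈ G.feasible) (i : Fin N) :
    ‖G.proxResponse η c i x - G.proxResponse η c i y‖ ^ 2 ≤
      4 * (∑ i, M i) / c * ‖x - y‖ + ‖x - y‖ ^ 2 := by
  have hBx := (hG.proxResponse_spec hη hdom hM hc hx i).1
  have hBy := (hG.proxResponse_spec hη hdom hM hc hy i).1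
  -- Test the growth inequality of each point with the other's minimizer and add. What remains are
  -- potential differences between profiles with the same own coordinate, each at most `K * δ`, and
  -- the cross term `c⟪a - b, x i - y i⟫`.
  have h1 := hP.prox_growth hG hη hdom hM hc hx hBy
  have h2 := hP.prox_growth hG hη hdom hM hc hy hBx
  have h3 := (abs_le.1 (hP.abs_sub_le_norm hG hη hdom hM0 hM (update_mem_feasible hx hBy)
    (update_mem_feasible hy hBy))).2
  have h4 := (abs_le.1 (hP.abs_sub_le_norm hG hη hdom hM0 hM (update_mem_feasible hx hBx)
    (update_mem_feasible hy hBx))).1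
  set K := ∑ i, M i
  have hK : 0 ≤ K := Finset.sum_nonneg fun i _ => (hM0 i).le
  set a := G.proxResponse η c i x
  set b := G.proxResponse η c i y
  have h5 := mul_le_mul_of_nonneg_left (norm_update_sub_update_le (i := i) x y a) hK
  have h6 := mul_le_mul_of_nonneg_left (norm_update_sub_update_le (i := i) x y b) hK
  have h7 : ‖b - x i‖ ^ 2 - ‖b - y i‖ ^ 2 + ‖a - y i‖ ^ 2 - ‖a - x i‖ ^ 2
      = 2 * inner ℝ (a - b) (x i - y i) := by
    simp only [norm_sub_sq_real, inner_sub_left, inner_sub_right]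
    ring
  have h8 := real_inner_le_norm (a - b) (x i - y i)
  have h9 : ‖x i - y i‖ ≤ ‖x - y‖ := norm_le_pi_norm (x - y) i
  have h10 := mul_le_mul_of_nonneg_left h9 (norm_nonneg (a - b))
  rw [norm_sub_rev b a] at h1
  set δ := ‖x - y‖
  set s := ‖a - b‖
  have h11 : c * s ^ 2 ≤ 2 * (K * δ) + c * (s * δ) := by nlinarith
  -- Young's inequality `2 * s * δ ≤ s ^ 2 + δ ^ 2` absorbs the cross term.
  have h12 : c * s ^ 2 ≤ 4 * K * δ + c * δ ^ 2 := by nlinarith [mul_nonneg hc.le (sq_nonneg (s - δ))]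
  have h13 : 4 * K / c * δ + δ ^ 2 = (4 * K * δ + c * δ ^ 2) / c := by field_simp
  rw [h13, le_div_iff₀ hc]
  linarith

theorem IsSmoothedPotential.uniformContinuousOn_proxResponse (hG : G.IsHierConvex) (hη : 0 < η)
    (hdom : ∀ i, ∀ v ∈ G.strat i, Metric.closedBall v η ⊆ G.dom i)
    (hM0 : ∀ i, 0 < M i) (hM : G.GradBoundedBy η M) (hP : G.IsSmoothedPotential η P)
    (hc : 0 < c) (i : Fin N) : UniformContinuousOn (G.proxResponse η c i) G.feasible := by
  rw [Metric.uniformContinuousOn_iff]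
  intro ε hε
  have hlim : Tendsto (fun δ : ℝ => 4 * (∑ i, M i) / c * δ + δ ^ 2) (𝓝 0) (𝓝 0) := by
    have : Continuous (fun δ : ℝ => 4 * (∑ i, M i) / c * δ + δ ^ 2) := by fun_prop
    simpa using this.tendsto 0
  obtain ⟨δ, hδ, h⟩ := Metric.eventually_nhds_iff.1 (hlim.eventually_lt_const (pow_pos hε 2))
  refine ⟨δ, hδ, fun x hx y hy hxy => ?_⟩
  rw [dist_eq_norm]
  refine lt_of_pow_lt_pow_left₀ 2 hε.le
    ((hP.norm_proxResponse_sub_sq_le hG hη hdom hM0 hM hc hx hy i).trans_lt (h ?_))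
  rwa [dist_zero_right, norm_norm, ← dist_eq_norm]

theorem IsSmoothedPotential.uniformContinuousOn_norm_proxResponse_sub (hG : G.IsHierConvex)
    (hη : 0 < η) (hdom : ∀ i, ∀ v ∈ G.strat i, Metric.closedBall v η ⊆ G.dom i)
    (hM0 : ∀ i, 0 < M i) (hM : G.GradBoundedBy η M) (hP : G.IsSmoothedPotential η P)
    (hc : 0 < c) (i : Fin N) :
    UniformContinuousOn (fun x => ‖G.proxResponse η c i x - x i‖) G.feasible := by
  have h1 := uniformContinuousOn_iff_restrict.1
    (hP.uniformContinuousOn_proxResponse hG hη hdom hM0 hM hc i)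
  have h2 : UniformContinuous (fun x : G.feasible => (x : Profile n) i) :=
    (Pi.uniformContinuous_proj _ i).comp uniformContinuous_subtype_val
  exact uniformContinuousOn_iff_restrict.2 (uniformContinuous_norm.comp (h1.sub h2))

end Prox

/-! ### Descent along one exact or perturbed step. -/

section Step

theorem relaxedStep_eq_update (x : Profile n) (s : Fin N) :
    G.relaxedStep η c t x s =
      Function.update x s ((1 - t) • x s + t • G.proxResponse η c s x) := by
  funext j
  by_cases h : j = s
  · subst h; simp [relaxedStep]
  · simp [relaxedStep, h]

/-- The descent lemma with `inner_prox_le`, transferred to `P`. Only feasibility of the new point is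
used, not `t ≤ 1`. -/
theorem IsSmoothedPotential.relaxedStep_le (hG : G.IsHierConvex) (hη : 0 < η)
    (hdom : ∀ i, ∀ v ∈ G.strat i, Metric.closedBall v η ⊆ G.dom i)
    (hL : G.IsSmoothWith η L) (hM : G.GradBoundedBy η M) (hP : G.IsSmoothedPotential η P)
    (hc : 0 < c) (ht : 0 < t) (hx : x ∈ G.feasible) {s : Fin N}
    (hz : G.relaxedStep η c t x s ∈ G.feasible) :
    P (G.relaxedStep η c t x s) ≤
      P x - t * (c - L * t / 2) * ‖G.proxResponse η c s x - x s‖ ^ 2 := by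
  have hgrad : ∀ z ∈ G.strat s, HasGradientAt
      (fun v => G.smoothedCost η s (Function.update x s v))
      (G.smoothedGrad η s (Function.update x s z)) z :=
    fun z hz => hG.hasGradientAt_smoothedCost hη hdom hx hz
  have hlip : ∀ z ∈ G.strat s, ∀ z' ∈ G.strat s,
      ‖G.smoothedGrad η s (Function.update x s z) - G.smoothedGrad η s (Function.update x s z')‖
        ≤ L * ‖z - z'‖ := fun z hz z' hz' => by
    simpa using hL.lipschitz s _ (update_mem_feasible hx hz) z' hz'
  obtain ⟨h1, h2⟩ := hG.proxResponse_spec hη hdom hM hc hx s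
  have hzs := hz s
  rw [relaxedStep_eq_update] at hzs ⊢
  rw [Function.update_self] at hzs
  have h3 := (hG.strat_convex s).le_add_inner_add_sq hgrad hlip (hx s) hzs
  have h4 := (hG.convexOn_smoothedCost hη hdom hx s).inner_prox_le hgrad (hx s) h1 h2
  have h5 := hP s x hx _ hzs
  have h6 : (1 - t) • x s + t • G.proxResponse η c s x - x s =
      t • (G.proxResponse η c s x - x s) := by module
  rw [h6, inner_smul_right, norm_smul, Real.norm_eq_abs, abs_of_pos ht] at h3
  simp only [Function.update_eq_self] at h3 h4
  nlinarith [mul_le_mul_of_nonneg_left h4 ht.le]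

variable {s : Fin N} {e : Profile n}

theorem IsSmoothedPotential.perturbed_step_le (hG : G.IsHierConvex) (hη : 0 < η)
    (hdom : ∀ i, ∀ v ∈ G.strat i, Metric.closedBall v η ⊆ G.dom i)
    (hL : G.IsSmoothWith η L) (hM0 : ∀ i, 0 < M i) (hM : G.GradBoundedBy η M)
    (hP : G.IsSmoothedPotential η P)
    (hc : 0 < c) (ht : 0 < t) (hx : x ∈ G.feasible)
    (hz : G.relaxedStep η c t x s ∈ G.feasible) (hy : y ∈ G.feasible)
    (hstep : ∀ i, y i = G.relaxedStep η c t x s i + if i = s then e i else 0) :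
    P y ≤ P x - t * (c - L * t / 2) * ‖G.proxResponse η c s x - x s‖ ^ 2 +
      ∑ i, M i * ‖e i‖ := by
  have h1 := hP.relaxedStep_le hG hη hdom hL hM hc ht hx hz
  have h2 := (abs_le.1 (hP.abs_sub_le hG hη hdom hM hy hz)).2
  have h3 : ∑ i, M i * ‖y i - G.relaxedStep η c t x s i‖ ≤ ∑ i, M i * ‖e i‖ := by
    refine Finset.sum_le_sum fun i _ => mul_le_mul_of_nonneg_left ?_ (hM0 i).le
    rw [hstep i, add_sub_cancel_left]
    split_ifs <;> simp
  linarith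

theorem IsHierConvex.norm_perturbed_step_sub_le (hG : G.IsHierConvex) (hη : 0 < η)
    (hdom : ∀ i, ∀ v ∈ G.strat i, Metric.closedBall v η ⊆ G.dom i)
    (hM0 : ∀ i, 0 < M i) (hM : G.GradBoundedBy η M)
    (hc : 0 < c) (ht : 0 < t) (hx : x ∈ G.feasible)
    (hstep : ∀ i, y i = G.relaxedStep η c t x s i + if i = s then e i else 0) :
    ‖y - x‖ ≤ (∑ i, M i) / c * t + ∑ i, ‖e i‖ := by
  have hK : 0 ≤ ∑ i, M i := Finset.sum_nonneg fun i _ => (hM0 i).le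
  refine (pi_norm_le_iff_of_nonneg (by positivity)).2 fun j => ?_
  rw [Pi.sub_apply, hstep j, relaxedStep_eq_update]
  by_cases h : j = s
  · subst h
    rw [Function.update_self, if_pos rfl]
    have h6 : (1 - t) • x j + t • G.proxResponse η c j x + e j - x j =
      t • (G.proxResponse η c j x - x j) + e j := by module
    rw [h6]
    refine (norm_add_le _ _).trans (add_le_add ?_
      (Finset.single_le_sum (fun i _ => norm_nonneg (e i)) (Finset.mem_univ j)))
    rw [norm_smul, Real.norm_eq_abs, abs_of_pos ht, mul_comm]
    refine mul_le_mul_of_nonneg_right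
      ((hG.norm_proxResponse_sub_le hη hdom hM hc hx j).trans ?_) ht.le
    gcongr
    exact Finset.single_le_sum (fun i _ => (hM0 i).le) (Finset.mem_univ j)
  · rw [Function.update_of_ne h, if_neg h]
    simp only [add_zero, sub_self, norm_zero]
    positivity

end Step

end HierGame

/-! ### Almost supermartingales. -/

section AlmostSupermartingale

variable {Ω : Type*} {mΩ : MeasurableSpace Ω} {μ : Measure Ω}

/-- If the partial sums of nonnegative integrable functions have bounded integrals, the series
converges almost everywhere. -/
theorem ae_summable_of_sum_integral_le {a : ℕ → Ω → ℝ} (ha : ∀ k, Integrable (a k) μ)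
    (ha0 : ∀ k, 0 ≤ᵐ[μ] a k) {C : ℝ} (hC : ∀ K, ∑ k ∈ Finset.range K, ∫ ω, a k ω ∂μ ≤ C) :
    ∀ᵐ ω ∂μ, Summable fun k => a k ω := by
  have hlint : ∫⁻ ω, ∑' k, ENNReal.ofReal (a k ω) ∂μ ≠ ⊤ := by
    rw [lintegral_tsum fun k => (ha k).aestronglyMeasurable.aemeasurable.ennreal_ofReal]
    refine ne_top_of_le_ne_top (ENNReal.ofReal_ne_top (r := C)) ?_
    refine ENNReal.tsum_le_of_sum_range_le fun K => ?_
    simp_rw [← ofReal_integral_eq_lintegral_ofReal (ha _) (ha0 _)]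
    rw [← ENNReal.ofReal_sum_of_nonneg fun k _ => integral_nonneg_of_ae (ha0 k)]
    exact ENNReal.ofReal_le_ofReal (hC K)
  have hfin := ae_lt_top' (AEMeasurable.tsum fun k =>
    (ha k).aestronglyMeasurable.aemeasurable.ennreal_ofReal) hlint
  filter_upwards [hfin, ae_all_iff.2 ha0] with ω hω hω0
  have := ENNReal.summable_toReal hω.ne
  refine this.congr fun k => ?_
  rw [ENNReal.toReal_ofReal (hω0 k)]

/-- Robbins–Siegmund type lemma: in an almost supermartingale inequality with almost surely
summable perturbations, the decrements are almost surely summable. -/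
theorem ae_summable_of_setIntegral_le [IsFiniteMeasure μ] (ℱ : Filtration ℕ mΩ) {V a b : ℕ → Ω → ℝ}
    (hV : ∀ k, Integrable (V k) μ) (hV0 : ∀ k, 0 ≤ᵐ[μ] V k)
    (ha : ∀ k, Integrable (a k) μ) (ha0 : ∀ k, 0 ≤ᵐ[μ] a k)
    (hb : ∀ k, Integrable (b k) μ) (hb0 : ∀ k, 0 ≤ᵐ[μ] b k)
    (hbm : ∀ k, StronglyMeasurable[ℱ k] (b k))
    (hstep : ∀ k, ∀ A, MeasurableSet[ℱ k] A →
      ∫ ω in A, V (k + 1) ω ∂μ + ∫ ω in A, a k ω ∂μ ≤ ∫ ω in A, V k ω ∂μ + ∫ ω in A, b k ω ∂μ)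
    (hsum : ∀ᵐ ω ∂μ, Summable fun k => b k ω) :
    ∀ᵐ ω ∂μ, Summable fun k => a k ω := by
  -- Localization: `A r k` is the event that the partial sums of `b`, including the term of index
  -- `k`, have not exceeded `r`. It belongs to `ℱ k` and decreases in `k`, so the inequality can be
  -- integrated over it and telescoped.
  let A : ℕ → ℕ → Set Ω := fun r k => {ω | ∀ j ≤ k, ∑ l ∈ Finset.range (j + 1), b l ω ≤ r}
  have hA : ∀ r k, MeasurableSet[ℱ k] (A r k) := by
    intro r k
    have : A r k = ⋂ j ∈ Finset.range (k + 1),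
        {ω | ∑ l ∈ Finset.range (j + 1), b l ω ≤ r} := by
      ext ω; simp [A]
    rw [this]
    refine Finset.measurableSet_biInter _ fun j hj => ?_
    suffices h : Measurable[ℱ k] fun ω => ∑ l ∈ Finset.range (j + 1), b l ω from
      h measurableSet_Iic
    refine Finset.measurable_fun_sum _ fun l hl => ?_
    refine (hbm l).measurable.mono (ℱ.mono ?_) le_rfl
    simp only [Finset.mem_range] at hj hl
    omega
  have hA' : ∀ r k, MeasurableSet (A r k) := fun r k => ℱ.le k _ (hA r k)
  have hanti : ∀ r k, A r (k + 1) ⊆ A r k := fun r k ω hω j hj => hω j (by omega)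
  have key : ∀ r, ∀ᵐ ω ∂μ, Summable fun k => (A r k).indicator (a k) ω := by
    intro r
    refine ae_summable_of_sum_integral_le (C := ∫ ω, V 0 ω ∂μ + μ.real Set.univ * r)
      (fun k => (ha k).indicator (hA' r k)) (fun k => ?_) fun K => ?_
    · filter_upwards [ha0 k] with ω hω
      exact Set.indicator_apply_nonneg fun _ => hω
    have h1 : ∀ K, ∑ k ∈ Finset.range K, ∫ ω in A r k, a k ω ∂μ + ∫ ω in A r K, V K ω ∂μ ≤
        ∫ ω, V 0 ω ∂μ + ∑ k ∈ Finset.range K, ∫ ω in A r k, b k ω ∂μ := by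
      intro K
      induction K with
      | zero => simpa using setIntegral_le_integral (hV 0) (hV0 0)
      | succ K ih =>
        rw [Finset.sum_range_succ, Finset.sum_range_succ]
        have h2 := hstep K _ (hA r K)
        have h3 : ∫ ω in A r (K + 1), V (K + 1) ω ∂μ ≤ ∫ ω in A r K, V (K + 1) ω ∂μ :=
          setIntegral_mono_set (hV _).integrableOn (ae_restrict_of_ae (hV0 _))
            (hanti r K).eventuallyLE
        linarith
    have h4 : ∑ k ∈ Finset.range K, ∫ ω in A r k, b k ω ∂μ ≤ μ.real Set.univ * r := by
      simp_rw [← integral_indicator (hA' r _)]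
      rw [← integral_finsetSum _ fun k _ => (hb k).indicator (hA' r k), ← smul_eq_mul,
        ← integral_const]
      refine integral_mono_ae (integrable_finsetSum _ fun k _ => (hb k).indicator (hA' r k))
        (integrable_const _) ?_
      -- Pointwise the localized sum is at most `r`: either `ω` is still in the last event, which
      -- bounds the full sum, or the last term drops out.
      filter_upwards [ae_all_iff.2 hb0] with ω hω
      induction K with
      | zero => simp
      | succ K ih =>
        by_cases hK : ω ∈ A r K
        · refine le_trans (Finset.sum_le_sum fun k _ => ?_) (hK K le_rfl)
          exact Set.indicator_le_self' (fun _ _ => hω k) ω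
        · rw [Finset.sum_range_succ, Set.indicator_of_notMem hK, add_zero]
          exact ih
    have h5 : 0 ≤ ∫ ω in A r K, V K ω ∂μ := integral_nonneg_of_ae (ae_restrict_of_ae (hV0 K))
    simp_rw [integral_indicator (hA' r _)]
    linarith [h1 K]
  filter_upwards [ae_all_iff.2 key, hsum, ae_all_iff.2 hb0] with ω h1 h2 h3
  -- For `r` above the total sum, `ω` lies in every `A r k` and the localization is invisible.
  obtain ⟨r, hr⟩ := exists_nat_ge (∑' k, b k ω)
  refine (h1 r).congr fun k => ?_
  rw [Set.indicator_of_mem]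
  exact fun j _ => (h2.sum_le_tsum _ fun k _ => h3 k).trans hr

/-- Nonnegative random variables are almost surely summable where their conditional expectations
are. -/
theorem ae_summable_of_ae_summable_condExp [IsFiniteMeasure μ] (ℱ : Filtration ℕ mΩ) {a : ℕ → Ω → ℝ}
    (ha : ∀ k, Integrable (a k) μ) (ha0 : ∀ k, 0 ≤ᵐ[μ] a k)
    (hsum : ∀ᵐ ω ∂μ, Summable fun k => (μ[a k | ℱ k]) ω) :
    ∀ᵐ ω ∂μ, Summable fun k => a k ω := by
  -- With `V = 0` and `b` the conditional expectation of `a`, the required inequality is an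
  -- equality.
  refine ae_summable_of_setIntegral_le ℱ (V := fun _ _ => 0) (b := fun k => μ[a k | ℱ k])
    (fun _ => integrable_zero _ _ _) (fun _ => ae_of_all _ fun _ => le_rfl) ha ha0
    (fun _ => integrable_condExp) (fun k => condExp_nonneg (ha0 k))
    (fun _ => stronglyMeasurable_condExp) (fun k A hA => ?_) hsum
  rw [setIntegral_condExp (ℱ.le k) (ha k) hA]

/-- Robbins–Siegmund type lemma with conditional expectations. -/
theorem ae_summable_of_condExp_le [IsFiniteMeasure μ] (ℱ : Filtration ℕ mΩ) {V a b : ℕ → Ω → ℝ}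
    (hV : ∀ k, Integrable (V k) μ) (hV0 : ∀ k, 0 ≤ᵐ[μ] V k)
    (ha : ∀ k, Integrable (a k) μ) (ha0 : ∀ k, 0 ≤ᵐ[μ] a k)
    (hb : ∀ k, Integrable (b k) μ) (hb0 : ∀ k, 0 ≤ᵐ[μ] b k)
    (hbm : ∀ k, StronglyMeasurable[ℱ k] (b k))
    (hstep : ∀ k, μ[V (k + 1) | ℱ k] ≤ᵐ[μ] fun ω => V k ω - a k ω + b k ω)
    (hsum : ∀ᵐ ω ∂μ, Summable fun k => b k ω) :
    ∀ᵐ ω ∂μ, Summable fun k => a k ω := by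
  refine ae_summable_of_setIntegral_le ℱ hV hV0 ha ha0 hb hb0 hbm (fun k A hA => ?_) hsum
  rw [← setIntegral_condExp (ℱ.le k) (hV (k + 1)) hA]
  have h1 := setIntegral_mono_ae (s := A) integrable_condExp.integrableOn
    (((hV k).sub (ha k)).add (hb k)).integrableOn (hstep k)
  have h2 : ∫ ω in A, (V k - a k + b k) ω ∂μ =
      ∫ ω in A, V k ω ∂μ - ∫ ω in A, a k ω ∂μ + ∫ ω in A, b k ω ∂μ := by
    rw [integral_add' ((hV k).sub (ha k)).integrableOn (hb k).integrableOn,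
      integral_sub' (hV k).integrableOn (ha k).integrableOn]
  rw [h2] at h1
  linarith

end AlmostSupermartingale

/-! ### From weighted summability to convergence. -/

/-- A uniformly continuous function of a sequence whose steps are controlled by `γ`, and whose
squares are `γ`-weighted summable, tends to zero. -/
theorem UniformContinuousOn.tendsto_zero_of_summable_mul_sq {X : Type*} [PseudoMetricSpace X]
    {S : Set X} {r : X → ℝ} (hr : UniformContinuousOn r S) (hr0 : ∀ z ∈ S, 0 ≤ r z)
    {x : ℕ → X} (hx : ∀ k, x k ∈ S) {γ e : ℕ → ℝ} {C : ℝ} (hC : 0 ≤ C) (hγ : ∀ k, 0 < γ k)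
    (hγ0 : Tendsto γ atTop (𝓝 0)) (hγs : ¬ Summable γ) (he0 : ∀ k, 0 ≤ e k) (he : Summable e)
    (hdist : ∀ k, dist (x (k + 1)) (x k) ≤ C * γ k + e k)
    (hsum : Summable fun k => γ k * r (x k) ^ 2) :
    Tendsto (fun k => r (x k)) atTop (𝓝 0) := by
  rw [Metric.tendsto_atTop]
  intro ε' hε'
  obtain ⟨ε, hε, rfl⟩ : ∃ ε > 0, 2 * ε = ε' := ⟨ε' / 2, by positivity, by ring⟩
  obtain ⟨δ, hδ, hδr⟩ := Metric.uniformContinuousOn_iff.1 hr ε hε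
  -- While `r (x k) ≥ ε`, the term `q k` dominates the step length, since then `γ k ≤ γ k * r (x k)
  -- ^ 2 / ε ^ 2`.
  let q : ℕ → ℝ := fun k => C / ε ^ 2 * (γ k * r (x k) ^ 2) + e k
  have hq : Summable q := (hsum.mul_left _).add he
  have hq0 : ∀ k, 0 ≤ q k := fun k =>
    add_nonneg (mul_nonneg (by positivity) (mul_nonneg (hγ k).le (sq_nonneg _))) (he0 k)
  have hlim1 : ∀ᶠ k in atTop, C * γ k < δ / 3 := by
    have := hγ0.const_mul C
    rw [mul_zero] at this
    exact this.eventually_lt_const (by positivity)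
  have hlim2 : ∀ᶠ k in atTop, e k < δ / 3 :=
    he.tendsto_atTop_zero.eventually_lt_const (by positivity)
  have hlim3 : ∀ᶠ K in atTop, ∑' k, q (k + K) < δ / 3 :=
    (tendsto_sum_nat_add q).eventually_lt_const (by positivity)
  obtain ⟨K, hK⟩ := eventually_atTop.1 (hlim1.and (hlim2.and hlim3))
  have htail : ∀ s t, K ≤ s → ∑ k ∈ Finset.Ico s t, q k < δ / 3 := by
    intro s t hs
    rw [Finset.sum_Ico_eq_sum_range]
    refine lt_of_le_of_lt ?_ (hK s hs).2.2
    simp_rw [add_comm s]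
    exact ((summable_nat_add_iff s).2 hq).sum_le_tsum _ fun k _ => hq0 _
  -- Otherwise `γ` would be summable by comparison.
  obtain ⟨s₀, hs₀, hs₀r⟩ : ∃ s ≥ K, r (x s) < ε := by
    by_contra! h
    refine hγs ((summable_nat_add_iff K).1 ?_)
    refine Summable.of_nonneg_of_le (fun k => (hγ _).le) (fun k => ?_)
      (((summable_nat_add_iff K).2 hsum).mul_left (1 / ε ^ 2))
    have h1 : ε ^ 2 ≤ r (x (k + K)) ^ 2 := pow_le_pow_left₀ hε.le (h _ (by omega)) 2
    rw [one_div, ← div_eq_inv_mul, le_div_iff₀ (by positivity)]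
    exact mul_le_mul_of_nonneg_left h1 (hγ _).le
  -- Here `s` is the last index before `t` with `r (x s) < ε` (or `t` itself at the start). The step
  -- leaving `s` is not controlled by `q` and is counted separately; with three contributions below
  -- `δ / 3`, `r` changes by less than `ε`.
  have key : ∀ t ≥ s₀, ∃ s, K ≤ s ∧ s ≤ t ∧ r (x s) < ε ∧
      dist (x t) (x s) ≤ C * γ s + e s + ∑ k ∈ Finset.Ico s t, q k := by
    intro t ht
    induction t, ht using Nat.le_induction with
    | base =>
      refine ⟨s₀, hs₀, le_rfl, hs₀r, ?_⟩
      rw [dist_self, Finset.Ico_self, Finset.sum_empty, add_zero]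
      exact add_nonneg (mul_nonneg hC (hγ _).le) (he0 _)
    | succ t ht ih =>
      obtain ⟨s, hKs, hst, hsr, hd⟩ := ih
      by_cases hrt : r (x t) < ε
      · refine ⟨t, hKs.trans hst, Nat.le_succ t, hrt, (hdist t).trans ?_⟩
        exact le_add_of_nonneg_right (Finset.sum_nonneg fun k _ => hq0 k)
      · refine ⟨s, hKs, hst.trans (Nat.le_succ t), hsr, ?_⟩
        rw [Finset.sum_Ico_succ_top hst]
        have h1 : C * γ t ≤ C / ε ^ 2 * (γ t * r (x t) ^ 2) := by
          have h2 : ε ^ 2 ≤ r (x t) ^ 2 := pow_le_pow_left₀ hε.le (not_lt.1 hrt) 2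
          rw [div_mul_eq_mul_div, le_div_iff₀ (by positivity)]
          nlinarith [mul_le_mul_of_nonneg_left h2 (mul_nonneg hC (hγ t).le)]
        have h3 := dist_triangle (x (t + 1)) (x t) (x s)
        have h4 := hdist t
        simp only [q] at hd ⊢
        linarith
  refine ⟨s₀, fun t ht => ?_⟩
  obtain ⟨s, hKs, hst, hsr, hd⟩ := key t ht
  have h1 := htail s t hKs
  obtain ⟨h2, h3, -⟩ := hK s hKs
  have h4 := hδr _ (hx t) _ (hx s) (by linarith)
  rw [Real.dist_eq] at h4
  rw [Real.dist_eq, sub_zero, abs_of_nonneg (hr0 _ (hx t))]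
  linarith [(abs_lt.1 h4).2]

theorem ContinuousOn.measurable_indicator {X : Type*} [TopologicalSpace X] [MeasurableSpace X]
    [OpensMeasurableSpace X] {f : X → ℝ} {s : Set X} (hf : ContinuousOn f s)
    (hs : MeasurableSet s) : Measurable (s.indicator f) := by
  classical
  rw [← Set.piecewise_eq_indicator]
  exact hf.measurable_piecewise continuousOn_const hs

/-- Potential and responses are controlled only on the feasible set; extending by zero off it gives
a measurable function that agrees almost surely along the iterates. -/
theorem ContinuousOn.aestronglyMeasurable_comp {X Ω : Type*} [TopologicalSpace X]
    [MeasurableSpace X] [BorelSpace X] [TopologicalSpace.PseudoMetrizableSpace X]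
    {m mΩ : MeasurableSpace Ω} {μ : Measure Ω} {f : X → ℝ} {s : Set X} (hf : ContinuousOn f s)
    (hs : MeasurableSet s) {g : Ω → X} (hg : StronglyMeasurable[m] g) (hgs : ∀ᵐ ω ∂μ, g ω ∈ s) :
    AEStronglyMeasurable[m] (fun ω => f (g ω)) μ := by
  refine ⟨fun ω => s.indicator f (g ω),
    ((hf.measurable_indicator hs).comp hg.measurable).stronglyMeasurable, ?_⟩
  filter_upwards [hgs] with ω hω
  rw [Set.indicator_of_mem hω]

/-! ### Integrability and the conditional descent inequality. -/

namespace HierGame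

variable {N : ℕ} {n m : Fin N → ℕ} {Ξ : Type*} [MeasurableSpace Ξ] {G : HierGame N n m Ξ}
  {η L c Plow : ℝ} {M : Fin N → ℝ} {P : Profile n → ℝ}
  {Ω : Type*} {mΩ : MeasurableSpace Ω} {μ : Measure Ω}
  {ℱ : Filtration ℕ mΩ} {γ : ℕ → ℝ} {p : Fin N → ℝ}
  {x : ℕ → Ω → Profile n} {sel : ℕ → Ω → Fin N} {e : ℕ → Ω → Profile n}

theorem IsARSPBR.ae_mem_feasible (h : G.IsARSPBR η c γ p μ ℱ x sel e) (k : ℕ) :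
    ∀ᵐ ω ∂μ, x k ω ∈ G.feasible := by
  filter_upwards [h.feasible] with ω hω using (hω k).1

theorem IsARSPBR.integrable_norm_error (h : G.IsARSPBR η c γ p μ ℱ x sel e) (k : ℕ) (i : Fin N) :
    Integrable (fun ω => ‖e (k + 1) ω i‖) μ :=
  ((h.error_integrable k).eval i).norm

theorem IsARSPBR.ae_dist_le (h : G.IsARSPBR η c γ p μ ℱ x sel e)
    (hG : G.IsHierConvex) (hη : 0 < η)
    (hdom : ∀ i, ∀ v ∈ G.strat i, Metric.closedBall v η ⊆ G.dom i)
    (hM0 : ∀ i, 0 < M i) (hM : G.GradBoundedBy η M) (hc : 0 < c) :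
    ∀ᵐ ω ∂μ, ∀ k, dist (x (k + 1) ω) (x k ω) ≤
      (∑ i, M i) / c * γ k + ∑ i, ‖e (k + 1) ω i‖ := by
  filter_upwards [h.feasible, h.update] with ω h1 h2 k
  rw [dist_eq_norm]
  exact hG.norm_perturbed_step_sub_le hη hdom hM0 hM hc (h.relax_pos k) (h1 k).1 (h2 k)

set_option linter.unusedSectionVars false

variable [IsProbabilityMeasure μ]

theorem IsARSPBR.integrable_iterate (h : G.IsARSPBR η c γ p μ ℱ x sel e)
    (hG : G.IsHierConvex) (hη : 0 < η)
    (hdom : ∀ i, ∀ v ∈ G.strat i, Metric.closedBall v η ⊆ G.dom i)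
    (hM0 : ∀ i, 0 < M i) (hM : G.GradBoundedBy η M) (hc : 0 < c) (k : ℕ) :
    Integrable (x k) μ := by
  induction k with
  | zero => exact h.init_integrable
  | succ k ih =>
    have hb : Integrable (fun ω => ‖x k ω‖ +
        ((∑ i, M i) / c * γ k + ∑ i, ‖e (k + 1) ω i‖)) μ :=
      ih.norm.add ((integrable_const _).add
        (integrable_finsetSum _ fun i _ => h.integrable_norm_error k i))
    refine hb.mono' ((h.adapted (k + 1)).mono (ℱ.le _)).aestronglyMeasurable ?_
    filter_upwards [h.ae_dist_le hG hη hdom hM0 hM hc] with ω hω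
    have h1 := hω k
    rw [dist_eq_norm] at h1
    linarith [norm_le_norm_add_norm_sub' (x (k + 1) ω) (x k ω)]

theorem IsARSPBR.integrable_potential (h : G.IsARSPBR η c γ p μ ℱ x sel e)
    (hG : G.IsHierConvex) (hη : 0 < η)
    (hdom : ∀ i, ∀ v ∈ G.strat i, Metric.closedBall v η ⊆ G.dom i)
    (hM0 : ∀ i, 0 < M i) (hM : G.GradBoundedBy η M) (hP : G.IsSmoothedPotential η P)
    (hc : 0 < c) (k : ℕ) : Integrable (fun ω => P (x k ω)) μ := by
  obtain ⟨y, hy⟩ := hG.feasible_nonempty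
  have hb : Integrable (fun ω => |P y| + (∑ i, M i) * ‖x k ω - y‖) μ :=
    (integrable_const _).add
      (((h.integrable_iterate hG hη hdom hM0 hM hc k).sub (integrable_const y)).norm.const_mul _)
  refine hb.mono' ((hP.continuousOn hG hη hdom hM0 hM).aestronglyMeasurable_comp
    hG.isClosed_feasible.measurableSet ((h.adapted k).mono (ℱ.le _)) (h.ae_mem_feasible k)) ?_
  filter_upwards [h.ae_mem_feasible k] with ω hω
  have h1 := hP.abs_sub_le_norm hG hη hdom hM0 hM hω hy
  rw [Real.norm_eq_abs]
  linarith [abs_sub_abs_le_abs_sub (P (x k ω)) (P y)]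

theorem IsARSPBR.aestronglyMeasurable_prox (h : G.IsARSPBR η c γ p μ ℱ x sel e)
    (hG : G.IsHierConvex) (hη : 0 < η)
    (hdom : ∀ i, ∀ v ∈ G.strat i, Metric.closedBall v η ⊆ G.dom i)
    (hM0 : ∀ i, 0 < M i) (hM : G.GradBoundedBy η M) (hP : G.IsSmoothedPotential η P)
    (hc : 0 < c) (k : ℕ) (i : Fin N) :
    AEStronglyMeasurable[ℱ k] (fun ω => ‖G.proxResponse η c i (x k ω) - x k ω i‖ ^ 2) μ :=
  ((hP.uniformContinuousOn_norm_proxResponse_sub hG hη hdom hM0 hM hc i).continuousOn.pow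
    2).aestronglyMeasurable_comp hG.isClosed_feasible.measurableSet (h.adapted k)
      (h.ae_mem_feasible k)

theorem IsARSPBR.ae_prox_le (h : G.IsARSPBR η c γ p μ ℱ x sel e)
    (hG : G.IsHierConvex) (hη : 0 < η)
    (hdom : ∀ i, ∀ v ∈ G.strat i, Metric.closedBall v η ⊆ G.dom i)
    (hM : G.GradBoundedBy η M) (hc : 0 < c) (k : ℕ) (i : Fin N) :
    ∀ᵐ ω ∂μ, ‖‖G.proxResponse η c i (x k ω) - x k ω i‖ ^ 2‖ ≤ (M i / c) ^ 2 := by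
  filter_upwards [h.ae_mem_feasible k] with ω hω
  rw [norm_pow, norm_norm]
  exact pow_le_pow_left₀ (norm_nonneg _) (hG.norm_proxResponse_sub_le hη hdom hM hc hω i) 2

theorem IsARSPBR.integrable_prox (h : G.IsARSPBR η c γ p μ ℱ x sel e)
    (hG : G.IsHierConvex) (hη : 0 < η)
    (hdom : ∀ i, ∀ v ∈ G.strat i, Metric.closedBall v η ⊆ G.dom i)
    (hM0 : ∀ i, 0 < M i) (hM : G.GradBoundedBy η M) (hP : G.IsSmoothedPotential η P)
    (hc : 0 < c) (k : ℕ) (i : Fin N) :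
    Integrable (fun ω => ‖G.proxResponse η c i (x k ω) - x k ω i‖ ^ 2) μ :=
  (integrable_const ((M i / c) ^ 2)).mono'
    ((h.aestronglyMeasurable_prox hG hη hdom hM0 hM hP hc k i).mono (ℱ.le k))
    (h.ae_prox_le hG hη hdom hM hc k i)

/-- The random selection averages the squared displacement of each player. -/
theorem IsARSPBR.condExp_prox_mul_indicator (h : G.IsARSPBR η c γ p μ ℱ x sel e)
    (hG : G.IsHierConvex) (hη : 0 < η)
    (hdom : ∀ i, ∀ v ∈ G.strat i, Metric.closedBall v η ⊆ G.dom i)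
    (hM0 : ∀ i, 0 < M i) (hM : G.GradBoundedBy η M) (hP : G.IsSmoothedPotential η P)
    (hc : 0 < c) (k : ℕ) (i : Fin N) :
    Integrable ((fun ω => ‖G.proxResponse η c i (x k ω) - x k ω i‖ ^ 2) *
      (sel k ⁻¹' {i}).indicator fun _ => (1 : ℝ)) μ ∧
    μ[(fun ω => ‖G.proxResponse η c i (x k ω) - x k ω i‖ ^ 2) *
      (sel k ⁻¹' {i}).indicator fun _ => (1 : ℝ) | ℱ k] =ᵐ[μ]
      fun ω => p i * ‖G.proxResponse η c i (x k ω) - x k ω i‖ ^ 2 := by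
  have hms : MeasurableSet (sel k ⁻¹' {i}) := h.sel_measurable k (measurableSet_singleton i)
  have hI : Integrable ((sel k ⁻¹' {i}).indicator fun _ => (1 : ℝ)) μ :=
    (integrable_const 1).indicator hms
  have hint : Integrable ((fun ω => ‖G.proxResponse η c i (x k ω) - x k ω i‖ ^ 2) *
      (sel k ⁻¹' {i}).indicator fun _ => (1 : ℝ)) μ :=
    hI.bdd_mul ((h.aestronglyMeasurable_prox hG hη hdom hM0 hM hP hc k i).mono (ℱ.le k))
      (h.ae_prox_le hG hη hdom hM hc k i)
  -- The displacement is determined by the history and bounded, so it factors out; what is left is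
  -- the selection probability.
  refine ⟨hint, (condExp_mul_of_aestronglyMeasurable_left
    (h.aestronglyMeasurable_prox hG hη hdom hM0 hM hP hc k i) hint hI).trans ?_⟩
  filter_upwards [h.sel_prob k i] with ω hω
  rw [Pi.mul_apply, hω, mul_comm]

/-- The displacement of the randomly selected player is written as a finite sum over players with
selection indicators, to which linearity of the conditional expectation applies. -/
theorem IsARSPBR.condExp_potential_le (h : G.IsARSPBR η c γ p μ ℱ x sel e)
    (hG : G.IsHierConvex) (hη : 0 < η)
    (hdom : ∀ i, ∀ v ∈ G.strat i, Metric.closedBall v η ⊆ G.dom i)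
    (hL : G.IsSmoothWith η L) (hM0 : ∀ i, 0 < M i) (hM : G.GradBoundedBy η M)
    (hP : G.IsSmoothedPotential η P) (hc : 0 < c) (k : ℕ) :
    μ[fun ω => P (x (k + 1) ω) - Plow | ℱ k] ≤ᵐ[μ] fun ω =>
      (P (x k ω) - Plow)
        - γ k * (c - L * γ k / 2) *
            ∑ i, p i * ‖G.proxResponse η c i (x k ω) - x k ω i‖ ^ 2
        + ∑ i, M i * (μ[fun ω' => ‖e (k + 1) ω' i‖ | ℱ k]) ω := by
  classical
  set U : Ω → ℝ := fun ω => P (x k ω) - Plow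
  set D : Fin N → Ω → ℝ := fun i =>
    (fun ω => ‖G.proxResponse η c i (x k ω) - x k ω i‖ ^ 2) *
      (sel k ⁻¹' {i}).indicator fun _ => (1 : ℝ)
  set ν : Fin N → Ω → ℝ := fun i ω => ‖e (k + 1) ω i‖
  set κ := γ k * (c - L * γ k / 2)
  have hD : ∀ i, Integrable (D i) μ ∧ μ[D i | ℱ k] =ᵐ[μ]
      fun ω => p i * ‖G.proxResponse η c i (x k ω) - x k ω i‖ ^ 2 := fun i =>
    h.condExp_prox_mul_indicator hG hη hdom hM0 hM hP hc k i
  have hν : ∀ i, Integrable (ν i) μ := h.integrable_norm_error k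
  have hUi : Integrable U μ :=
    (h.integrable_potential hG hη hdom hM0 hM hP hc k).sub (integrable_const _)
  have hUm : AEStronglyMeasurable[ℱ k] U μ :=
    ((hP.continuousOn hG hη hdom hM0 hM).aestronglyMeasurable_comp
      hG.isClosed_feasible.measurableSet (h.adapted k) (h.ae_mem_feasible k)).sub
      aestronglyMeasurable_const
  have hDi : Integrable (κ • ∑ i, D i) μ := (integrable_finsetSum' _ fun i _ => (hD i).1).smul κ
  have hMi : ∀ i ∈ Finset.univ, Integrable (M i • ν i) μ := fun i _ => (hν i).smul (M i)
  have hNi : Integrable (∑ i, M i • ν i) μ := integrable_finsetSum' _ hMi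
  have hle : (fun ω => P (x (k + 1) ω) - Plow) ≤ᵐ[μ] U - κ • ∑ i, D i + ∑ i, M i • ν i := by
    filter_upwards [h.feasible, h.update] with ω h1 h2
    have h3 := hP.perturbed_step_le hG hη hdom hL hM0 hM hc (h.relax_pos k) (h1 k).1 (h1 k).2
      (h1 (k + 1)).1 (h2 k)
    have h4 : (∑ i, D i) ω =
        ‖G.proxResponse η c (sel k ω) (x k ω) - x k ω (sel k ω)‖ ^ 2 := by
      rw [Finset.sum_apply, Finset.sum_eq_single (sel k ω)]
      · simp [D]
      · intro j _ hj
        simp [D, hj.symm]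
      · simp
    simp only [Pi.add_apply, Pi.sub_apply, Pi.smul_apply, smul_eq_mul, h4]
    simp only [Finset.sum_apply, Pi.smul_apply, smul_eq_mul, U, ν, κ]
    linarith
  have h1 := condExp_mono (m := ℱ k)
    ((h.integrable_potential hG hη hdom hM0 hM hP hc (k + 1)).sub (integrable_const Plow))
    ((hUi.sub hDi).add hNi) hle
  have h2 := condExp_add (hUi.sub hDi) hNi (ℱ k)
  have h3 := condExp_sub hUi hDi (ℱ k)
  have h4 := condExp_of_aestronglyMeasurable' (ℱ.le k) hUm hUi
  have h5 := condExp_smul (μ := μ) κ (∑ i, D i) (ℱ k)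
  have h6 := condExp_finsetSum (fun i (_ : i ∈ Finset.univ) => (hD i).1) (ℱ k)
  have h7 := condExp_finsetSum hMi (ℱ k)
  have h8 : ∀ᵐ ω ∂μ, ∀ i, (μ[D i | ℱ k]) ω =
      p i * ‖G.proxResponse η c i (x k ω) - x k ω i‖ ^ 2 := ae_all_iff.2 fun i => (hD i).2
  have h9 : ∀ᵐ ω ∂μ, ∀ i, (μ[M i • ν i | ℱ k]) ω = (M i • μ[ν i | ℱ k]) ω :=
    ae_all_iff.2 fun i => condExp_smul (M i) (ν i) (ℱ k)
  filter_upwards [h1, h2, h3, h4, h5, h6, h7, h8, h9] with ω h1 h2 h3 h4 h5 h6 h7 h8 h9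
  refine h1.trans (le_of_eq ?_)
  rw [h2, Pi.add_apply, h3, Pi.sub_apply, h4, h5, Pi.smul_apply, h6, h7, Finset.sum_apply,
    Finset.sum_apply]
  simp only [h8, h9, Pi.smul_apply, smul_eq_mul, U, κ, ν]

end HierGame

/-! ### Vanishing residual and limit points. -/

namespace HierGame

variable {N : ℕ} {n m : Fin N → ℕ} {Ξ : Type*} [MeasurableSpace Ξ] {G : HierGame N n m Ξ}
  {η L c Plow : ℝ} {M : Fin N → ℝ} {P : Profile n → ℝ}
  {Ω : Type*} {mΩ : MeasurableSpace Ω} {μ : Measure Ω}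
  {ℱ : Filtration ℕ mΩ} {γ : ℕ → ℝ} {p : Fin N → ℝ}
  {x : ℕ → Ω → Profile n} {sel : ℕ → Ω → Fin N} {e : ℕ → Ω → Profile n}

theorem proxResidual_eq (z : Profile n) :
    G.proxResidual η c z = ∑ i, ‖G.proxResponse η c i z - z i‖ ^ 2 := by
  simp only [proxResidual, norm_sub_rev]

theorem IsARSPBR.ae_summable_prox [IsProbabilityMeasure μ]
    (h : G.IsARSPBR η c γ p μ ℱ x sel e)
    (hG : G.IsHierConvex) (hη : 0 < η)
    (hdom : ∀ i, ∀ v ∈ G.strat i, Metric.closedBall v η ⊆ G.dom i)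
    (hL : G.IsSmoothWith η L) (hM0 : ∀ i, 0 < M i) (hM : G.GradBoundedBy η M)
    (hP : G.IsSmoothedPotential η P) (hPlow : ∀ x ∈ G.feasible, Plow ≤ P x) (hc : 0 < c)
    {κ : ℝ} (hκ : 0 < κ) (hκγ : ∀ k, κ ≤ c - L * γ k / 2)
    (hsum : ∀ᵐ ω ∂μ, Summable fun k =>
      ∑ i, M i * (μ[fun ω' => ‖e (k + 1) ω' i‖ | ℱ k]) ω) :
    ∀ᵐ ω ∂μ, ∀ i, Summable fun k =>
      γ k * ‖G.proxResponse η c i (x k ω) - x k ω i‖ ^ 2 := by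
  have hnn : ∀ k ω, 0 ≤ ∑ i, p i * ‖G.proxResponse η c i (x k ω) - x k ω i‖ ^ 2 := fun k ω =>
    Finset.sum_nonneg fun i _ => mul_nonneg (h.prob_pos i).le (sq_nonneg _)
  have hcoef : ∀ k, κ * γ k ≤ γ k * (c - L * γ k / 2) := fun k => by
    rw [mul_comm]
    exact mul_le_mul_of_nonneg_left (hκγ k) (h.relax_pos k).le
  have hcoef0 : ∀ k, 0 ≤ γ k * (c - L * γ k / 2) := fun k =>
    (mul_nonneg hκ.le (h.relax_pos k).le).trans (hcoef k)
  have key := ae_summable_of_condExp_le (μ := μ) ℱ (V := fun k ω => P (x k ω) - Plow)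
    (a := fun k ω => γ k * (c - L * γ k / 2) *
      ∑ i, p i * ‖G.proxResponse η c i (x k ω) - x k ω i‖ ^ 2)
    (b := fun k ω => ∑ i, M i * (μ[fun ω' => ‖e (k + 1) ω' i‖ | ℱ k]) ω)
    (fun k => (h.integrable_potential hG hη hdom hM0 hM hP hc k).sub (integrable_const _))
    (fun k => by
      filter_upwards [h.ae_mem_feasible k] with ω hω using sub_nonneg.2 (hPlow _ hω))
    (fun k => (integrable_finsetSum _ fun i _ =>
      (h.integrable_prox hG hη hdom hM0 hM hP hc k i).const_mul (p i)).const_mul _)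
    (fun k => ae_of_all _ fun ω => mul_nonneg (hcoef0 k) (hnn k ω))
    (fun k => integrable_finsetSum _ fun i _ => integrable_condExp.const_mul (M i))
    (fun k => by
      have : ∀ᵐ ω ∂μ, ∀ i, 0 ≤ (μ[fun ω' => ‖e (k + 1) ω' i‖ | ℱ k]) ω :=
        ae_all_iff.2 fun i => condExp_nonneg (ae_of_all _ fun _ => norm_nonneg _)
      filter_upwards [this] with ω hω
      exact Finset.sum_nonneg fun i _ => mul_nonneg (hM0 i).le (hω i))
    (fun k => Finset.stronglyMeasurable_fun_sum _ fun i _ =>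
      stronglyMeasurable_condExp.const_mul (M i))
    (fun k => h.condExp_potential_le hG hη hdom hL hM0 hM hP hc k) hsum
  filter_upwards [key] with ω hω i
  have hpi := h.prob_pos i
  refine Summable.of_nonneg_of_le (fun k => mul_nonneg (h.relax_pos k).le (sq_nonneg _))
    (fun k => ?_) (hω.mul_left (1 / (κ * p i)))
  rw [one_div, ← div_eq_inv_mul, le_div_iff₀ (mul_pos hκ hpi)]
  calc γ k * ‖G.proxResponse η c i (x k ω) - x k ω i‖ ^ 2 * (κ * p i)
      = κ * γ k * (p i * ‖G.proxResponse η c i (x k ω) - x k ω i‖ ^ 2) := by ring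
    _ ≤ γ k * (c - L * γ k / 2) *
        ∑ i, p i * ‖G.proxResponse η c i (x k ω) - x k ω i‖ ^ 2 :=
      mul_le_mul (hcoef k) (Finset.single_le_sum
        (f := fun i => p i * ‖G.proxResponse η c i (x k ω) - x k ω i‖ ^ 2)
        (fun i _ => mul_nonneg (h.prob_pos i).le (sq_nonneg _)) (Finset.mem_univ i))
        (mul_nonneg hpi.le (sq_nonneg _)) (hcoef0 k)

theorem IsARSPBR.ae_summable_norm_error [IsProbabilityMeasure μ]
    (h : G.IsARSPBR η c γ p μ ℱ x sel e) (hM0 : ∀ i, 0 < M i)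
    (hsum : ∀ᵐ ω ∂μ, Summable fun k =>
      ∑ i, M i * (μ[fun ω' => ‖e (k + 1) ω' i‖ | ℱ k]) ω) :
    ∀ᵐ ω ∂μ, Summable fun k => ∑ i, ‖e (k + 1) ω i‖ := by
  have hnn : ∀ᵐ ω ∂μ, ∀ k i, 0 ≤ (μ[fun ω' => ‖e (k + 1) ω' i‖ | ℱ k]) ω :=
    ae_all_iff.2 fun k => ae_all_iff.2 fun i =>
      condExp_nonneg (ae_of_all _ fun _ => norm_nonneg _)
  have key : ∀ i, ∀ᵐ ω ∂μ, Summable fun k => ‖e (k + 1) ω i‖ := fun i => by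
    refine ae_summable_of_ae_summable_condExp ℱ (fun k => h.integrable_norm_error k i)
      (fun k => ae_of_all _ fun _ => norm_nonneg _) ?_
    filter_upwards [hsum, hnn] with ω h1 h2
    refine Summable.of_nonneg_of_le (fun k => h2 k i) (fun k => ?_) (h1.mul_left (1 / M i))
    rw [one_div, ← div_eq_inv_mul, le_div_iff₀ (hM0 i), mul_comm]
    exact Finset.single_le_sum (f := fun i => M i * (μ[fun ω' => ‖e (k + 1) ω' i‖ | ℱ k]) ω)
      (fun i _ => mul_nonneg (hM0 i).le (h2 k i)) (Finset.mem_univ i)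
  filter_upwards [ae_all_iff.2 key] with ω hω
  exact summable_sum fun i _ => hω i

theorem tendsto_proxResidual_of_tendsto {y : ℕ → Profile n}
    (hy : ∀ i, Tendsto (fun k => ‖G.proxResponse η c i (y k) - y k i‖ ^ 2) atTop (𝓝 0)) :
    Tendsto (fun k => G.proxResidual η c (y k)) atTop (𝓝 0) := by
  simp only [proxResidual_eq]
  simpa using tendsto_finsetSum Finset.univ fun i _ => hy i

theorem IsARSPBR.ae_tendsto_proxResidual [IsProbabilityMeasure μ]
    (h : G.IsARSPBR η c γ p μ ℱ x sel e)
    (hG : G.IsHierConvex) (hη : 0 < η)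
    (hdom : ∀ i, ∀ v ∈ G.strat i, Metric.closedBall v η ⊆ G.dom i) (hL0 : 0 < L)
    (hL : G.IsSmoothWith η L) (hM0 : ∀ i, 0 < M i) (hM : G.GradBoundedBy η M)
    (hP : G.IsSmoothedPotential η P) (hPlow : ∀ x ∈ G.feasible, Plow ≤ P x) (hc : 0 < c)
    (hγ : (Antitone γ ∧ ¬ Summable γ ∧ Summable (fun k => γ k ^ 2) ∧ ∀ k, γ k < 2 * c / L) ∨
      ((∀ k, γ k = 1) ∧ L / 2 < c))
    (hsum : ∀ᵐ ω ∂μ, Summable fun k =>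
      ∑ i, M i * (μ[fun ω' => ‖e (k + 1) ω' i‖ | ℱ k]) ω) :
    ∀ᵐ ω ∂μ, Tendsto (fun k => G.proxResidual η c (x k ω)) atTop (𝓝 0) := by
  rcases hγ with ⟨hanti, hns, hsq, hlt⟩ | ⟨hone, hlt⟩
  · have h0 := hlt 0
    rw [lt_div_iff₀ hL0] at h0
    -- Monotonicity of `γ` makes the value at 0 a uniform positive lower bound for the descent
    -- coefficient.
    have hκγ : ∀ k, c - L * γ 0 / 2 ≤ c - L * γ k / 2 := fun k => by
      have := mul_le_mul_of_nonneg_left (hanti (Nat.zero_le k)) hL0.le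
      linarith
    have hγ0 : Tendsto γ atTop (𝓝 0) := by
      have h1 := (Real.continuous_sqrt.tendsto 0).comp hsq.tendsto_atTop_zero
      rw [Real.sqrt_zero] at h1
      exact h1.congr fun k => Real.sqrt_sq (h.relax_pos k).le
    filter_upwards [h.ae_summable_prox hG hη hdom hL hM0 hM hP hPlow hc (by linarith) hκγ hsum,
      h.ae_summable_norm_error hM0 hsum, h.feasible, h.ae_dist_le hG hη hdom hM0 hM hc]
      with ω h1 h2 h3 h4
    refine tendsto_proxResidual_of_tendsto fun i => ?_
    have hK : 0 ≤ (∑ i, M i) / c := div_nonneg (Finset.sum_nonneg fun i _ => (hM0 i).le) hc.le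
    have := (hP.uniformContinuousOn_norm_proxResponse_sub hG hη hdom hM0 hM hc
      i).tendsto_zero_of_summable_mul_sq (fun _ _ => norm_nonneg _) (fun k => (h3 k).1) hK
      h.relax_pos hγ0 hns (fun k => Finset.sum_nonneg fun i _ => norm_nonneg _) h2 h4 (h1 i)
    simpa using this.pow 2
  · filter_upwards [h.ae_summable_prox hG hη hdom hL hM0 hM hP hPlow hc
      (κ := c - L / 2) (by linarith) (fun k => by rw [hone k, mul_one]) hsum] with ω hω
    refine tendsto_proxResidual_of_tendsto fun i => ?_
    simpa [hone] using (hω i).tendsto_atTop_zero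

theorem IsSmoothedPotential.mem_smoothedNash_of_mapClusterPt (hG : G.IsHierConvex) (hη : 0 < η)
    (hdom : ∀ i, ∀ v ∈ G.strat i, Metric.closedBall v η ⊆ G.dom i)
    (hM0 : ∀ i, 0 < M i) (hM : G.GradBoundedBy η M)
    (hP : G.IsSmoothedPotential η P) (hc : 0 < c) {y : ℕ → Profile n}
    (hy : ∀ k, y k ∈ G.feasible)
    (hres : Tendsto (fun k => G.proxResidual η c (y k)) atTop (𝓝 0)) {z : Profile n}
    (hz : MapClusterPt z atTop y) : z ∈ G.smoothedNash η := by
  obtain ⟨φ, hφ, hlim⟩ := hz.tendsto_subseq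
  have hzF : z ∈ G.feasible :=
    hG.isClosed_feasible.mem_of_tendsto hlim (Eventually.of_forall fun k => hy _)
  refine hG.mem_smoothedNash_of_proxResponse_eq hη hdom hM hc hzF fun i => ?_
  have h1 : Tendsto (fun k => ‖G.proxResponse η c i (y (φ k)) - y (φ k) i‖) atTop
      (𝓝 ‖G.proxResponse η c i z - z i‖) :=
    ((hP.uniformContinuousOn_norm_proxResponse_sub hG hη hdom hM0 hM hc
      i).continuousOn z hzF).tendsto.comp
      (tendsto_nhdsWithin_iff.2 ⟨hlim, Eventually.of_forall fun k => hy _⟩)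
  have h2 : Tendsto (fun k => ‖G.proxResponse η c i (y (φ k)) - y (φ k) i‖ ^ 2) atTop (𝓝 0) := by
    refine squeeze_zero (fun k => sq_nonneg _) (fun k => ?_) (hres.comp hφ.tendsto_atTop)
    rw [Function.comp_apply, proxResidual_eq]
    exact Finset.single_le_sum
      (f := fun i => ‖G.proxResponse η c i (y (φ k)) - y (φ k) i‖ ^ 2)
      (fun i _ => sq_nonneg _) (Finset.mem_univ i)
  have h3 := tendsto_nhds_unique (h1.pow 2) h2
  exact sub_eq_zero.1 (norm_eq_zero.1 (pow_eq_zero_iff two_ne_zero |>.1 h3))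

end HierGame

/-! ### Distance to the equilibrium set and conclusion. -/

/-- A bounded sequence in a proper space approaches every set containing its cluster points. -/
theorem Bornology.IsBounded.tendsto_infDist_of_mapClusterPt {X : Type*} [PseudoMetricSpace X]
    [ProperSpace X] {y : ℕ → X} (hy : Bornology.IsBounded (Set.range y)) {S : Set X}
    (hS : ∀ z, MapClusterPt z atTop y → z ∈ S) :
    S.Nonempty ∧ Tendsto (fun k => Metric.infDist (y k) S) atTop (𝓝 0) := by
  have hmem : ∀ k, y k ∈ closure (Set.range y) := fun k => subset_closure (Set.mem_range_self k)
  have hcpt := hy.isCompact_closure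
  -- Nonemptiness carries content of its own: `Metric.infDist` to the empty set is 0.
  constructor
  · obtain ⟨z, -, hz⟩ := hcpt.exists_mapClusterPt_of_frequently (l := atTop)
      (Frequently.of_forall hmem)
    exact ⟨z, hS z hz⟩
  · rw [Metric.tendsto_atTop]
    intro ε hε
    by_contra! hcon
    have hfreq : ∃ᶠ k in atTop, y k ∈ closure (Set.range y) ∩ {z | ε ≤ Metric.infDist z S} := by
      refine frequently_atTop.2 fun K => ?_
      obtain ⟨k, hk, hεk⟩ := hcon K
      rw [Real.dist_eq, sub_zero, abs_of_nonneg Metric.infDist_nonneg] at hεk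
      exact ⟨k, hk, hmem k, hεk⟩
    obtain ⟨z, hzm, hz⟩ := (hcpt.inter_right (isClosed_le continuous_const
      (Metric.continuous_infDist_pt S))).exists_mapClusterPt_of_frequently hfreq
    have h1 : ε ≤ Metric.infDist z S := hzm.2
    rw [Metric.infDist_zero_of_mem (hS z hz)] at h1
    exact hε.not_ge h1

theorem mainTheorem4 {N : ℕ} {n m : Fin N → ℕ} {Ξ : Type*} [MeasurableSpace Ξ]
    (G : HierGame N n m Ξ) (hG : G.IsHierConvex)
    (η : ℝ) (hη : 0 < η) (hdom : ∀ i, ∀ v ∈ G.strat i, Metric.closedBall v η ⊆ G.dom i)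
    (hsub : G.HasBoundedSubgradients η)
    (P : Profile n → ℝ) (hP : G.IsSmoothedPotential η P)
    (Plow : ℝ) (hPlow : ∀ x ∈ G.feasible, Plow ≤ P x)
    (c : ℝ) (hc : 0 < c) :
    -- the constants `L` and `Mᵢ` exist
    (∃ L : ℝ, 0 < L ∧ G.IsSmoothWith η L) ∧
    (∃ M : Fin N → ℝ, (∀ i, 0 < M i) ∧ G.GradBoundedBy η M) ∧
    -- and for any such constants and any sequence generated by the scheme:
    ∀ (L : ℝ) (M : Fin N → ℝ), 0 < L → G.IsSmoothWith η L →
      (∀ i, 0 < M i) → G.GradBoundedBy η M →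
      ∀ {Ω : Type*} {mΩ : MeasurableSpace Ω} (μ : Measure Ω) [IsProbabilityMeasure μ]
        (ℱ : Filtration ℕ mΩ) (γ : ℕ → ℝ) (p : Fin N → ℝ)
        (x : ℕ → Ω → Profile n) (sel : ℕ → Ω → Fin N) (e : ℕ → Ω → Profile n),
        G.IsARSPBR η c γ p μ ℱ x sel e →
        -- (a) supermartingale-type descent inequality
        (∀ k, Integrable (fun ω => P (x k ω)) μ ∧
          μ[fun ω => P (x (k + 1) ω) - Plow | ℱ k] ≤ᵐ[μ] fun ω =>
            (P (x k ω) - Plow)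
              - γ k * (c - L * γ k / 2) *
                  ∑ i, p i * ‖G.proxResponse η c i (x k ω) - x k ω i‖ ^ 2
              + ∑ i, M i * (μ[fun ω' => ‖e (k + 1) ω' i‖ | ℱ k]) ω) ∧
        -- (b) the residual vanishes almost surely
        (((Antitone γ ∧ ¬ Summable γ ∧ Summable (fun k => γ k ^ 2) ∧ ∀ k, γ k < 2 * c / L) ∨
            ((∀ k, γ k = 1) ∧ L / 2 < c)) →
          (∀ᵐ ω ∂μ, Summable fun k =>
            ∑ i, M i * (μ[fun ω' => ‖e (k + 1) ω' i‖ | ℱ k]) ω) →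
          ∀ᵐ ω ∂μ, Tendsto (fun k => G.proxResidual η c (x k ω)) atTop (𝓝 0)) ∧
        -- (c) convergence to the Nash equilibria of the smoothed game
        ((∀ᵐ ω ∂μ, Tendsto (fun k => G.proxResidual η c (x k ω)) atTop (𝓝 0)) →
          ∀ᵐ ω ∂μ,
            (∀ x' : Profile n, MapClusterPt x' atTop (fun k => x k ω) →
              x' ∈ G.smoothedNash η) ∧
            (Bornology.IsBounded (Set.range fun k => x k ω) →
              (G.smoothedNash η).Nonempty ∧
              Tendsto (fun k => Metric.infDist (x k ω) (G.smoothedNash η)) atTop (𝓝 0))) := by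
  refine ⟨hG.exists_isSmoothWith hη hdom hsub, hG.exists_gradBoundedBy hη hdom hsub, ?_⟩
  intro L M hL0 hL hM0 hM Ω mΩ μ _ ℱ γ p x sel e h
  refine ⟨fun k => ⟨h.integrable_potential hG hη hdom hM0 hM hP hc k,
    h.condExp_potential_le hG hη hdom hL hM0 hM hP hc k⟩,
    h.ae_tendsto_proxResidual hG hη hdom hL0 hL hM0 hM hP hPlow hc, fun hres => ?_⟩
  filter_upwards [hres, h.feasible] with ω hω hfeas
  have hcl : ∀ z, MapClusterPt z atTop (fun k => x k ω) → z ∈ G.smoothedNash η := fun z hz =>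
    hP.mem_smoothedNash_of_mapClusterPt hG hη hdom hM0 hM hc (fun k => (hfeas k).1) hω hz
  exact ⟨hcl, fun hb => hb.tendsto_infDist_of_mapClusterPt hcl⟩
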